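/- Theorem 6.1. Let $\mathcal{M}$ be a structure with domain $\mathbb{R}$, over a signature whose symbols are numbered (the symbols of each arity injectively) by natural numbers, that expands $\langle \mathbb{R},+,<,1\rangle$. Assume that $\mathcal{M}$ is decidable, i.e. the set of Gödel numbers of the first-order sentences true in $\mathcal{M}$ is recursive, and that for every $n$ every nonempty $\mathcal{M}$-definable relation $Y\subseteq\mathbb{R}^n$ contains a point of $\mathbb{Q}^n$. (Definable means definable by a first-order formula with equality, without parameters.) Then it is decidable whether an $\mathcal{M}$-definable relation $X\subseteq\mathbb{R}^n$, given by a formula defining it, is $\langle\mathbb{R},+,<,1\rangle$-definable: the set of pairs $(n,c)$ such that $c$ is the Gödel number of a formula $\psi(x_1,\dots,x_n)$ in the signature of $\mathcal{M}$ for which $\{a\in\mathbb{R}^n : \mathcal{M}\models\psi(a)\}$ is $\langle\mathbb{R},+,<,1\rangle$-definable is recursive. -/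

import Mathlib

open FirstOrder

namespace RealAdd

/-- The function symbols of the signature `{+, <, 1}`. -/
inductive Func : ℕ → Type
  | one : Func 0
  | add : Func 2

/-- The relation symbols of the signature `{+, <, 1}`. -/
inductive Rel : ℕ → Type
  | lt : Rel 2

/-- The signature `{+, <, 1}`. -/
def lang : Language where
  Functions := Func
  Relations := Rel

/-- The structure `⟨ℝ, +, <, 1⟩`. -/
noncomputable instance instStructureReal : lang.Structure ℝ where
  funMap := fun {_} f => match f with
    | Func.one => fun _ => 1
    | Func.add => fun x => x 0 + x 1
  RelMap := fun {_} r => match r with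
    | Rel.lt => fun x => x 0 < x 1

section Coding

variable {L : Language} [∀ n, Encodable (L.Functions n)]

/-- Gödel numbers of terms. The symbols of each arity are numbered by the `Encodable` instances;
the arity of a symbol can be read off the length of its list of arguments. -/
def termCode {α : Type} [Encodable α] : L.Term α → ℕ
  | .var a => Nat.pair 0 (Encodable.encode a)
  | .func f ts => Nat.pair 1 (Nat.pair (Encodable.encode f)
      (Encodable.encode (List.ofFn fun i => termCode (ts i))))

/-- Gödel numbers of first-order formulas with equality: free variables are indexed by `α`, and
bound variables by `Fin k`. -/
def formulaCode [∀ n, Encodable (L.Relations n)] {α : Type} [Encodable α] :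
    ∀ {k : ℕ}, L.BoundedFormula α k → ℕ
  | _, .falsum => Nat.pair 0 0
  | _, .equal t u => Nat.pair 1 (Nat.pair (termCode t) (termCode u))
  | _, .rel R ts => Nat.pair 2 (Nat.pair (Encodable.encode R)
      (Encodable.encode (List.ofFn fun i => termCode (ts i))))
  | _, .imp φ ψ => Nat.pair 3 (Nat.pair (formulaCode φ) (formulaCode ψ))
  | _, .all φ => Nat.pair 4 (formulaCode φ)

end Coding

/-- The structure that `L` puts on `ℝ` is decidable: the set of Gödel numbers of the `L`-sentences
that are true in it is recursive. -/
def IsDecidable (L : Language) [L.Structure ℝ]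
    [∀ n, Encodable (L.Functions n)] [∀ n, Encodable (L.Relations n)] : Prop :=
  ComputablePred fun c : ℕ => ∃ σ : L.Sentence, formulaCode σ = c ∧ σ.Realize ℝ

/-- Definability over `ℝ` by an `L`-formula, without parameters. -/
def IsDefinable (L : Language) [L.Structure ℝ] {n : ℕ} (X : Set (Fin n → ℝ)) : Prop :=
  (∅ : Set ℝ).Definable L X

end RealAdd

namespace RealAdd

open Filter Topology Set Metric

/-! ### Local cones and their directions of invariance -/

section Strata

variable {E : Type*} [NormedAddCommGroup E] [NormedSpace ℝ E]

/-- Inside `ball x r`, the set `X` is a cone with apex `x`. -/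
def ConicAt (X : Set E) (x : E) (r : ℝ) : Prop :=
  ∀ y ∈ ball x r, ∀ t ∈ Ioc (0 : ℝ) 1, (y ∈ X ↔ x + t • (y - x) ∈ X)

/-- Every point is the apex of a cone with which `X` coincides near the point. -/
def LocallyConic (X : Set E) : Prop :=
  ∀ x, ∃ r > 0, ConicAt X x r

/-- The directions along which `X` is translation invariant near `x`. -/
def strat (X : Set E) (x : E) : Submodule ℝ E where
  carrier := {v | ∀ᶠ p : E × ℝ in 𝓝 (x, 0), (p.1 ∈ X ↔ p.1 + p.2 • v ∈ X)}
  zero_mem' := by simp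
  add_mem' := by
    intro v w hv hw
    have h1 : Tendsto (fun p : E × ℝ => (p.1 + p.2 • v, p.2)) (𝓝 (x, 0)) (𝓝 (x, 0)) := by
      have : Continuous (fun p : E × ℝ => (p.1 + p.2 • v, p.2)) := by fun_prop
      simpa using this.tendsto (x, 0)
    have h2 := h1.eventually hw
    filter_upwards [hv, h2] with p h3 h4
    rw [h3, h4]
    simp [add_assoc, smul_add]
  smul_mem' := by
    intro c v hv
    have h1 : Tendsto (fun p : E × ℝ => (p.1, p.2 * c)) (𝓝 (x, 0)) (𝓝 (x, 0)) := by
      have : Continuous (fun p : E × ℝ => (p.1, p.2 * c)) := by fun_prop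
      simpa using this.tendsto (x, 0)
    filter_upwards [h1.eventually hv] with p h3
    simpa [smul_smul] using h3

theorem mem_strat {X : Set E} {x v : E} :
    v ∈ strat X x ↔ ∀ᶠ p : E × ℝ in 𝓝 (x, 0), (p.1 ∈ X ↔ p.1 + p.2 • v ∈ X) := Iff.rfl

/-- The affine subspace through `x` with direction `strat X x`. -/
def flat (X : Set E) (x : E) : Set E := {z | z - x ∈ strat X x}

variable {X : Set E} {x y v : E} {r : ℝ}

theorem flat_eq_of_strat_eq (h : strat X x = strat X y) (hxy : x - y ∈ strat X y) :
    flat X x = flat X y := by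
  ext z
  simp only [flat, h]
  constructor <;> intro hz
  · have := (strat X y).add_mem hz hxy
    simpa using this
  · have := (strat X y).sub_mem hz hxy
    simpa using this

/-- Scaling about the apex by an arbitrary positive factor. -/
theorem ConicAt.scale (h : ConicAt X x r) {t : ℝ} (ht : 0 < t) (hy : y ∈ ball x r)
    (hy' : x + t • (y - x) ∈ ball x r) : y ∈ X ↔ x + t • (y - x) ∈ X := by
  rcases le_or_gt t 1 with h1 | h1
  · exact h y hy t ⟨ht, h1⟩
  · have := h _ hy' t⁻¹ ⟨inv_pos.2 ht, inv_le_one_of_one_le₀ h1.le⟩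
    rw [this]
    simp [smul_smul, inv_mul_cancel₀ ht.ne']

theorem tendsto_mul_zero_pair (x a b : E) (c : ℝ) :
    Tendsto (fun t : ℝ => (x + t • a + t • b, t * c)) (𝓝[>] 0) (𝓝 (x, 0)) := by
  have : Continuous (fun t : ℝ => (x + t • a + t • b, t * c)) := by fun_prop
  have h := this.tendsto 0
  simp only [zero_smul, add_zero, zero_mul] at h
  exact h.mono_left nhdsWithin_le_nhds

/-- Contracting `y` and `y + v` towards the apex by the same small factor brings them to where the
infinitesimal invariance applies, and the cone property carries the result back. -/
theorem ConicAt.iff_add_of_mem_strat (h : ConicAt X x r) (hv : v ∈ strat X x)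
    (hy : y ∈ ball x r) (hyv : y + v ∈ ball x r) : y ∈ X ↔ y + v ∈ X := by
  have h1 : ∀ᶠ t : ℝ in 𝓝[>] 0, t ∈ Ioc (0 : ℝ) 1 := Ioc_mem_nhdsGT one_pos
  have h2 := (tendsto_mul_zero_pair x (y - x) 0 1).eventually hv
  obtain ⟨t, ht, h2⟩ := (h1.and h2).exists
  rw [h y hy t ht, h _ hyv t ht]
  simp only [smul_zero, add_zero, mul_one] at h2
  rw [h2]
  congr! 1
  rw [add_assoc, ← smul_add]
  congr 2
  abel

theorem ConicAt.strat_le (h : ConicAt X x r) (hy : y ∈ ball x r) :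
    strat X x ≤ strat X y := by
  intro v hv
  have h1 : ∀ᶠ p : E × ℝ in 𝓝 (y, 0), p.1 ∈ ball x r :=
    continuous_fst.tendsto (y, (0 : ℝ)) (isOpen_ball.mem_nhds hy)
  have h2 : ∀ᶠ p : E × ℝ in 𝓝 (y, 0), p.1 + p.2 • v ∈ ball x r := by
    have : Continuous (fun p : E × ℝ => p.1 + p.2 • v) := by fun_prop
    exact this.tendsto (y, (0 : ℝ)) (isOpen_ball.mem_nhds (by simpa using hy))
  filter_upwards [h1, h2] with p h1 h2
  exact h.iff_add_of_mem_strat ((strat X x).smul_mem _ hv) h1 h2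

/-- Scaling about the apex `x` and scaling back about `y` amounts to a translation along `y - x`. -/
theorem ConicAt.sub_mem_strat (hX : LocallyConic X) (h : ConicAt X x r) (hy : y ∈ ball x r) :
    y - x ∈ strat X y := by
  obtain ⟨s, hs, hc⟩ := hX y
  have hopen : ∀ {g : E × ℝ → E} {U : Set E}, ContinuousAt g (y, 0) → IsOpen U → g (y, 0) ∈ U →
      ∀ᶠ p in 𝓝 (y, 0), g p ∈ U := fun hg hU hm => hg.preimage_mem_nhds (hU.mem_nhds hm)
  have h0 : ∀ᶠ p : E × ℝ in 𝓝 (y, 0), -1 < p.2 :=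
    continuous_snd.tendsto (y, (0 : ℝ)) (Ioi_mem_nhds (by simp))
  have hcont : ContinuousAt (fun p : E × ℝ => y + (1 + p.2)⁻¹ • (p.1 - y)) (y, 0) := by
    apply ContinuousAt.add continuousAt_const
    apply ContinuousAt.smul
    · apply ContinuousAt.inv₀
      · fun_prop
      · simp
    · fun_prop
  have h1 : ∀ᶠ p : E × ℝ in 𝓝 (y, 0), p.1 ∈ ball y s :=
    hopen (by fun_prop) isOpen_ball (by simpa using hs)
  have h2 : ∀ᶠ p : E × ℝ in 𝓝 (y, 0), y + (1 + p.2)⁻¹ • (p.1 - y) ∈ ball y s :=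
    hopen hcont isOpen_ball (by simpa using hs)
  have h3 : ∀ᶠ p : E × ℝ in 𝓝 (y, 0), y + (1 + p.2)⁻¹ • (p.1 - y) ∈ ball x r :=
    hopen hcont isOpen_ball (by simpa using hy)
  have h4 : ∀ᶠ p : E × ℝ in 𝓝 (y, 0), p.1 + p.2 • (y - x) ∈ ball x r :=
    hopen (by fun_prop) isOpen_ball (by simpa using hy)
  filter_upwards [h0, h1, h2, h3, h4] with p h0 h1 h2 h3 h4
  have hp : 0 < 1 + p.2 := by linarith
  rw [hc.scale (inv_pos.2 hp) h1 h2]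
  have key : x + (1 + p.2) • (y + (1 + p.2)⁻¹ • (p.1 - y) - x) = p.1 + p.2 • (y - x) := by
    rw [add_sub_right_comm, smul_add, smul_smul, mul_inv_cancel₀ hp.ne', one_smul, add_smul,
      one_smul]
    abel
  rw [h.scale hp h3 (by rwa [key]), key]

theorem strat_eq_of_germ_eq (h : ∀ᶠ w in 𝓝 (0 : E), (x + w ∈ X ↔ y + w ∈ X)) :
    strat X x = strat X y := by
  have key : ∀ {x y : E}, (∀ᶠ w in 𝓝 (0 : E), (x + w ∈ X ↔ y + w ∈ X)) →
      strat X x ≤ strat X y := by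
    intro x y h v hv
    rw [mem_strat] at hv ⊢
    have h1 : Tendsto (fun p : E × ℝ => (x + (p.1 - y), p.2)) (𝓝 (y, 0)) (𝓝 (x, 0)) := by
      have : Continuous (fun p : E × ℝ => (x + (p.1 - y), p.2)) := by fun_prop
      simpa using this.tendsto (y, 0)
    have h2 : Tendsto (fun p : E × ℝ => p.1 - y) (𝓝 (y, 0)) (𝓝 0) := by
      have : Continuous (fun p : E × ℝ => p.1 - y) := by fun_prop
      simpa using this.tendsto (y, (0 : ℝ))
    have h3 : Tendsto (fun p : E × ℝ => p.1 + p.2 • v - y) (𝓝 (y, 0)) (𝓝 0) := by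
      have : Continuous (fun p : E × ℝ => p.1 + p.2 • v - y) := by fun_prop
      simpa using this.tendsto (y, (0 : ℝ))
    filter_upwards [h1.eventually hv, h2.eventually h, h3.eventually h] with p h1 h2 h3
    have e1 : y + (p.1 - y) = p.1 := by abel
    have e2 : y + (p.1 + p.2 • v - y) = p.1 + p.2 • v := by abel
    have e3 : x + (p.1 + p.2 • v - y) = x + (p.1 - y) + p.2 • v := by abel
    rw [e1] at h2
    rw [e2, e3] at h3
    rw [← h2, h1, h3]
  exact le_antisymm (key h) (key (h.mono fun w hw => hw.symm))

theorem ConicAt.strat_add_eq (h : ConicAt X x r) (hv : v ∈ strat X x)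
    (hy : y ∈ ball x r) (hyv : y + v ∈ ball x r) : strat X (y + v) = strat X y := by
  symm
  apply strat_eq_of_germ_eq
  have h1 : ∀ᶠ w in 𝓝 (0 : E), y + w ∈ ball x r := by
    have : Continuous (fun w : E => y + w) := by fun_prop
    exact this.tendsto 0 (isOpen_ball.mem_nhds (by simpa using hy))
  have h2 : ∀ᶠ w in 𝓝 (0 : E), y + w + v ∈ ball x r := by
    have : Continuous (fun w : E => y + w + v) := by fun_prop
    exact this.tendsto 0 (isOpen_ball.mem_nhds (by simpa using hyv))
  filter_upwards [h1, h2] with w h1 h2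
  rw [h.iff_add_of_mem_strat hv h1 h2, add_right_comm]

theorem ConicAt.flat_add_eq (h : ConicAt X x r) (hv : v ∈ strat X x)
    (hy : y ∈ ball x r) (hyv : y + v ∈ ball x r) : flat X (y + v) = flat X y :=
  flat_eq_of_strat_eq (h.strat_add_eq hv hy hyv) (by simpa using h.strat_le hy hv)

theorem ConicAt.strat_smul_eq (h : ConicAt X x r) {w : E} {t : ℝ} (ht : 0 < t)
    (hw : x + w ∈ ball x r) (htw : x + t • w ∈ ball x r) :
    strat X (x + t • w) = strat X (x + w) := by
  have key : ∀ {w : E} {t : ℝ}, 0 < t → x + w ∈ ball x r → x + t • w ∈ ball x r →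
      strat X (x + t • w) ≤ strat X (x + w) := by
    intro w t ht hw htw v hv
    rw [mem_strat] at hv ⊢
    have h1 : Tendsto (fun p : E × ℝ => (x + t • (p.1 - x), t * p.2)) (𝓝 (x + w, 0))
        (𝓝 (x + t • w, 0)) := by
      have : Continuous (fun p : E × ℝ => (x + t • (p.1 - x), t * p.2)) := by fun_prop
      simpa using this.tendsto (x + w, 0)
    have hopen : ∀ {g : E × ℝ → E}, Continuous g → g (x + w, 0) ∈ ball x r →
        ∀ᶠ p in 𝓝 (x + w, 0), g p ∈ ball x r := fun hg hm =>
      hg.continuousAt.preimage_mem_nhds (isOpen_ball.mem_nhds hm)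
    have h2 := hopen (g := fun p => p.1) (by fun_prop) hw
    have h3 := hopen (g := fun p => x + t • (p.1 - x)) (by fun_prop) (by simpa using htw)
    have h4 := hopen (g := fun p => p.1 + p.2 • v) (by fun_prop) (by simpa using hw)
    have h5 := hopen (g := fun p => x + t • (p.1 + p.2 • v - x)) (by fun_prop)
      (by simpa using htw)
    filter_upwards [h1.eventually hv, h2, h3, h4, h5] with p h1 h2 h3 h4 h5
    rw [h.scale ht h2 h3, h.scale ht h4 h5, h1]
    congr! 1
    simp only [smul_sub, smul_add, smul_smul]
    abel
  refine le_antisymm (key ht hw htw) ?_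
  have := key (w := t • w) (t := t⁻¹) (inv_pos.2 ht) htw
    (by simpa [smul_smul, inv_mul_cancel₀ ht.ne'] using hw)
  simpa [smul_smul, inv_mul_cancel₀ ht.ne'] using this

theorem ConicAt.flat_smul_eq (hX : LocallyConic X) (h : ConicAt X x r) {w : E} {t : ℝ}
    (ht : 0 < t) (hw : x + w ∈ ball x r) (htw : x + t • w ∈ ball x r) :
    flat X (x + t • w) = flat X (x + w) := by
  refine flat_eq_of_strat_eq (h.strat_smul_eq ht hw htw) ?_
  have h1 : w ∈ strat X (x + w) := by simpa using h.sub_mem_strat hX hw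
  have h2 : x + t • w - (x + w) = (t - 1) • w := by
    rw [sub_smul, one_smul]; abel
  rw [h2]
  exact (strat X _).smul_mem _ h1

/-- A single small period near the apex of a cone is a direction of invariance. -/
theorem ConicAt.mem_strat_of_shift (h : ConicAt X x r) {δ : ℝ} (hδ : 0 < δ)
    (hr : δ + ‖v‖ ≤ r) (hv : ∀ y ∈ ball x δ, (y ∈ X ↔ y + v ∈ X)) : v ∈ strat X x := by
  have hδr : δ ≤ r := by linarith [norm_nonneg v]
  -- Contraction by `t` turns the period `v` on the ball of radius `δ` into the period `t • v` on
  -- the ball of radius `t * δ`.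
  have key : ∀ (t : ℝ) (w : E), 0 < t → t ≤ 1 → ‖w‖ < t * δ →
      (x + w ∈ X ↔ x + w + t • v ∈ X) := by
    intro t w ht ht1 hw
    have e1 : x + t • (x + t⁻¹ • w - x) = x + w := by
      simp [smul_smul, mul_inv_cancel₀ ht.ne']
    have hn : ‖t⁻¹ • w‖ < δ := by
      rw [norm_smul, norm_inv, Real.norm_of_nonneg ht.le, inv_mul_lt_iff₀ ht]
      exact hw
    have h1 : x + t⁻¹ • w ∈ ball x δ := by simpa [mem_ball, dist_eq_norm] using hn
    have h2 := h (x + t⁻¹ • w) (ball_subset_ball hδr h1) t ⟨ht, ht1⟩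
    rw [e1] at h2
    have h3 : x + t⁻¹ • w + v ∈ ball x r := by
      rw [mem_ball, dist_eq_norm]
      have : x + t⁻¹ • w + v - x = t⁻¹ • w + v := by abel
      rw [this]
      calc _ ≤ ‖t⁻¹ • w‖ + ‖v‖ := norm_add_le _ _
        _ < r := by linarith
    have h4 := h _ h3 t ⟨ht, ht1⟩
    have e2 : x + t • (x + t⁻¹ • w + v - x) = x + w + t • v := by
      have : x + t⁻¹ • w + v - x = t⁻¹ • w + v := by abel
      rw [this, smul_add, smul_smul, mul_inv_cancel₀ ht.ne', one_smul, add_assoc]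
    rw [e2] at h4
    rw [← h2, hv _ h1, h4]
  rw [mem_strat]
  -- A step `s` of either sign is the difference of the positive steps `1 / 2 + s` and `1 / 2`: the
  -- points `p` and `p + s • v` are both carried to `p + (1 / 2 + s) • v`.
  have hc1 : ∀ᶠ p : E × ℝ in 𝓝 (x, 0), ‖p.1 - x‖ < (1 / 2 + p.2) * δ := by
    have : Continuous (fun p : E × ℝ => (1 / 2 + p.2) * δ - ‖p.1 - x‖) := by fun_prop
    have h := this.tendsto (x, 0) (Ioi_mem_nhds (a := 0) (by simpa using hδ))
    filter_upwards [h] with p hp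
    simpa using hp
  have hc2 : ∀ᶠ p : E × ℝ in 𝓝 (x, 0), ‖p.1 + p.2 • v - x‖ < 1 / 2 * δ := by
    have : Continuous (fun p : E × ℝ => ‖p.1 + p.2 • v - x‖) := by fun_prop
    exact this.tendsto (x, (0 : ℝ)) (Iio_mem_nhds (by simpa using hδ))
  have hc3 : ∀ᶠ p : E × ℝ in 𝓝 (x, 0), p.2 ∈ Ioo (-1 / 2 : ℝ) (1 / 2) :=
    continuous_snd.tendsto (x, (0 : ℝ)) (Ioo_mem_nhds (by norm_num) (by norm_num))
  filter_upwards [hc1, hc2, hc3] with p h1 h2 h3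
  have k1 := key (1 / 2 + p.2) (p.1 - x) (by linarith [h3.1]) (by linarith [h3.2]) h1
  have k2 := key (1 / 2) (p.1 + p.2 • v - x) (by norm_num) (by norm_num) h2
  rw [add_sub_cancel] at k1 k2
  rw [k1, k2, add_smul, add_assoc, add_comm ((1 / 2 : ℝ) • v)]

end Strata

open Filter Topology Set Metric

/-! ### Finiteness of the set of flats -/

section Finiteness

variable {E : Type*} [NormedAddCommGroup E] [NormedSpace ℝ E]
variable {X : Set E}

/-- If every point of the segment from `x` to `y` has `y - x` among its directions of invariance,
then `X` does not separate `x` from `y`. -/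
theorem mem_iff_of_sub_mem_strat {x y : E}
    (h : ∀ s ∈ Icc (0 : ℝ) 1, y - x ∈ strat X (x + s • (y - x))) : x ∈ X ↔ y ∈ X := by
  set f : Icc (0 : ℝ) 1 → Prop := fun s => x + (s : ℝ) • (y - x) ∈ X with hf
  have hloc : IsLocallyConstant f := by
    rw [IsLocallyConstant.iff_eventually_eq]
    intro s
    have h1 : Tendsto (fun s' : Icc (0 : ℝ) 1 => (x + (s : ℝ) • (y - x), (s' : ℝ) - s)) (𝓝 s)
        (𝓝 (x + (s : ℝ) • (y - x), 0)) := by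
      have : Continuous fun s' : Icc (0 : ℝ) 1 => (x + (s : ℝ) • (y - x), (s' : ℝ) - s) := by
        fun_prop
      simpa using this.tendsto s
    filter_upwards [h1.eventually (h s s.2)] with s' hs'
    simp only [hf, eq_iff_iff]
    rw [hs']
    congr! 1
    rw [sub_smul]
    abel
  have := hloc.apply_eq_of_preconnectedSpace ⟨0, by simp⟩ ⟨1, by simp⟩
  simpa [hf] using this

variable [FiniteDimensional ℝ E]

/-- Induction on the codimension of `strat X x`. Up to translation along `strat X x` and scaling
about `x`, which preserve flats, a nearby point is `x` itself or lies on a compact sphere in a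
complement. On that sphere the space of directions is strictly larger, since it also contains the
radial direction. -/
theorem exists_nhds_finite_flats (hX : LocallyConic X) (x : E) :
    ∃ N ∈ 𝓝 x, (flat X '' N).Finite := by
  obtain ⟨k, hk⟩ : ∃ k, Module.finrank ℝ E ≤ Module.finrank ℝ (strat X x) + k :=
    ⟨Module.finrank ℝ E, by omega⟩
  induction k generalizing x with
  | zero =>
    have htop : strat X x = ⊤ := Submodule.eq_top_of_finrank_eq
      (le_antisymm (Submodule.finrank_le _) (by simpa using hk))
    obtain ⟨r, hr, hc⟩ := hX x
    refine ⟨ball x r, ball_mem_nhds x hr, (finite_singleton (flat X x)).subset ?_⟩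
    rintro _ ⟨y, hy, rfl⟩
    have h := hc.flat_add_eq (v := y - x) (y := x) (by simp [htop]) (mem_ball_self hr)
      (by simpa using hy)
    simpa using h
  | succ k ih =>
    obtain ⟨r, hr, hc⟩ := hX x
    obtain ⟨W, hW⟩ := Submodule.exists_isCompl (strat X x)
    set S : Set E := {w | w ∈ W ∧ ‖w‖ = r / 2} with hS
    have hScomp : IsCompact S := by
      have : S = sphere 0 (r / 2) ∩ W := by
        ext w; simp [hS, and_comm]
      rw [this]
      exact (isCompact_sphere _ _).inter_right W.closed_of_finiteDimensional
    have hSfin : ((fun w => flat X (x + w)) '' S).Finite := by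
      refine hScomp.induction_on (p := fun s => ((fun w => flat X (x + w)) '' s).Finite)
        (by simp) (fun s t hst ht => ht.subset (image_mono hst))
        (fun s t hs ht => by rw [image_union]; exact hs.union ht) ?_
      intro w hw
      have hwb : x + w ∈ ball x r := by
        rw [mem_ball, dist_eq_norm, add_sub_cancel_left, hw.2]; linarith
      have hlt : strat X x < strat X (x + w) := by
        refine lt_of_le_of_ne (hc.strat_le hwb) fun h => ?_
        have h1 : w ∈ strat X (x + w) := by simpa using hc.sub_mem_strat hX hwb
        rw [← h] at h1
        have h2 : w = 0 := Submodule.disjoint_def.1 hW.disjoint w h1 hw.1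
        have h3 := hw.2
        rw [h2, norm_zero] at h3
        linarith
      have := Submodule.finrank_lt_finrank_of_lt hlt
      obtain ⟨N, hN, hfin⟩ := ih (x + w) (by omega)
      refine ⟨(fun w => x + w) ⁻¹' N, mem_nhdsWithin_of_mem_nhds
        ((continuous_const.add continuous_id).continuousAt.preimage_mem_nhds hN),
        hfin.subset ?_⟩
      rintro _ ⟨w', hw', rfl⟩
      exact ⟨x + w', hw', rfl⟩
    -- The projection onto `W` along `strat X x`; it finds the translate of a nearby point that lies
    -- in `x + W`.
    set p : E →ₗ[ℝ] E := W.subtype ∘ₗ W.projectionOnto (strat X x) hW.symm with hp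
    have hpc : Continuous p := p.continuous_of_finiteDimensional
    have hpW : ∀ w, p w ∈ W := fun w => by simp [hp]
    have hpV : ∀ w, w - p w ∈ strat X x := by
      intro w
      have : w - p w ∈ LinearMap.ker (W.projectionOnto (strat X x) hW.symm) := by
        rw [LinearMap.mem_ker, map_sub, sub_eq_zero]
        exact (Submodule.projectionOnto_apply_left hW.symm _).symm
      simpa using this
    refine ⟨{y | ‖y - x‖ < r ∧ ‖p (y - x)‖ < r / 2}, ?_, ?_⟩
    · have h1 : Continuous fun y => ‖y - x‖ := by fun_prop
      have h2 : Continuous fun y => ‖p (y - x)‖ := by fun_prop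
      have h3 : ∀ᶠ y in 𝓝 x, ‖y - x‖ < r := h1.tendsto x (Iio_mem_nhds (by simpa using hr))
      have h4 : ∀ᶠ y in 𝓝 x, ‖p (y - x)‖ < r / 2 :=
        h2.tendsto x (Iio_mem_nhds (by simpa using hr))
      exact h3.and h4
    · refine (hSfin.union (finite_singleton (flat X x))).subset ?_
      rintro _ ⟨y, ⟨hy1, hy2⟩, rfl⟩
      set w := p (y - x) with hw
      have hwb : x + w ∈ ball x r := by
        rw [mem_ball, dist_eq_norm, add_sub_cancel_left]; linarith
      have hyw : flat X y = flat X (x + w) := by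
        have := hc.flat_add_eq (v := y - x - w) (y := x + w) (hpV _) hwb
          (by rw [mem_ball, dist_eq_norm]; simpa using hy1)
        rw [← this]
        congr 1
        abel
      rw [hyw]
      by_cases h0 : w = 0
      · right; simp [h0]
      left
      have hn : 0 < ‖w‖ := norm_pos_iff.2 h0
      have hpos : 0 < r / 2 / ‖w‖ := by positivity
      have hnorm : ‖(r / 2 / ‖w‖) • w‖ = r / 2 := by
        rw [norm_smul, Real.norm_of_nonneg hpos.le, div_mul_cancel₀ _ hn.ne']
      refine ⟨(r / 2 / ‖w‖) • w, ⟨W.smul_mem _ (hpW _), hnorm⟩, ?_⟩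
      refine hc.flat_smul_eq hX hpos hwb ?_
      rw [mem_ball, dist_eq_norm, add_sub_cancel_left, hnorm]
      linarith

/-- The closure of the points with a given flat contains the whole of some flat on which the
directions of invariance are constant. -/
theorem exists_minimal_flat (hX : LocallyConic X) (x : E) :
    ∃ z, ∀ y, y - z ∈ strat X z →
      strat X y = strat X z ∧ y ∈ closure {y | flat X y = flat X x} := by
  set A := closure {y | flat X y = flat X x} with hA
  have hne : A.Nonempty := ⟨x, subset_closure rfl⟩
  obtain ⟨z, hzA, hmin⟩ : ∃ z ∈ A, ∀ y ∈ A,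
      Module.finrank ℝ (strat X z) ≤ Module.finrank ℝ (strat X y) := by
    have hne' : ((fun z => Module.finrank ℝ (strat X z)) '' A).Nonempty := hne.image _
    obtain ⟨z, hz, he⟩ := Nat.sInf_mem hne'
    exact ⟨z, hz, fun y hy => by
      have h := Nat.sInf_le (mem_image_of_mem (fun z => Module.finrank ℝ (strat X z)) hy)
      rw [← he] at h
      exact h⟩
  refine ⟨z, fun y hy => ?_⟩
  set d := y - z with hd
  -- Connectedness of the line from `z` in direction `d`. `T` is open because small translations
  -- along `strat` preserve flats. It is closed because at a limit point `strat` can only get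
  -- smaller, which the minimal choice of `z` excludes.
  set T : Set ℝ := {s | strat X (z + s • d) = strat X z ∧ z + s • d ∈ A} with hT
  have hγ : Continuous fun s : ℝ => z + s • d := by fun_prop
  have hdiff : ∀ s s' : ℝ, z + s' • d = z + s • d + (s' - s) • d := by
    intro s s'; rw [sub_smul]; abel
  have hopen : IsOpen T := by
    rw [isOpen_iff_mem_nhds]
    rintro s ⟨hs1, hs2⟩
    obtain ⟨r, hr, hc⟩ := hX (z + s • d)
    have hnear : ∀ᶠ s' in 𝓝 s, z + s' • d ∈ ball (z + s • d) r :=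
      hγ.continuousAt.preimage_mem_nhds (ball_mem_nhds _ hr)
    filter_upwards [hnear] with s' hs'
    have hmem : (s' - s) • d ∈ strat X (z + s • d) := by
      rw [hs1]; exact (strat X z).smul_mem _ hy
    rw [hdiff s s'] at hs'
    refine ⟨?_, ?_⟩
    · rw [hdiff s s', hc.strat_add_eq hmem (mem_ball_self hr) hs', hs1]
    · rw [hdiff s s', hA, mem_closure_iff_frequently]
      have h1 := mem_closure_iff_frequently.1 hs2
      have h2 : ∀ᶠ y in 𝓝 (z + s • d), y ∈ ball (z + s • d) r ∧
          y + (s' - s) • d ∈ ball (z + s • d) r := by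
        have : Continuous fun y => y + (s' - s) • d := by fun_prop
        exact (ball_mem_nhds _ hr : _ ∈ 𝓝 _) |> fun h =>
          (h : ∀ᶠ y in 𝓝 (z + s • d), y ∈ ball (z + s • d) r).and
            (this.continuousAt.preimage_mem_nhds (isOpen_ball.mem_nhds hs'))
      have h3 : ∃ᶠ y in 𝓝 (z + s • d), flat X (y + (s' - s) • d) = flat X x := by
        refine (h1.and_eventually h2).mono ?_
        rintro y ⟨hy1, hy2, hy3⟩
        rw [hc.flat_add_eq hmem hy2 hy3]
        exact hy1
      have h4 : Tendsto (fun y => y + (s' - s) • d) (𝓝 (z + s • d))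
          (𝓝 (z + s • d + (s' - s) • d)) :=
        (continuous_id.add continuous_const).tendsto _
      exact h4.frequently h3
  have hclosed : IsClosed T := by
    rw [← isOpen_compl_iff, isOpen_iff_mem_nhds]
    intro s hs
    rw [← mem_interior_iff_mem_nhds]
    by_contra hcon
    rw [interior_compl, mem_compl_iff, not_not] at hcon
    apply hs
    have hsA : z + s • d ∈ A := by
      have : T ⊆ (fun s : ℝ => z + s • d) ⁻¹' A := fun s hs => hs.2
      exact (isClosed_closure.preimage hγ).closure_subset_iff.2 this hcon
    refine ⟨?_, hsA⟩
    obtain ⟨r, hr, hc⟩ := hX (z + s • d)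
    have hnear : ∀ᶠ s' in 𝓝 s, z + s' • d ∈ ball (z + s • d) r :=
      hγ.continuousAt.preimage_mem_nhds (ball_mem_nhds _ hr)
    obtain ⟨s', hs', hb⟩ := ((mem_closure_iff_frequently.1 hcon).and_eventually hnear).exists
    have hle : strat X (z + s • d) ≤ strat X z := by
      rw [← hs'.1]; exact hc.strat_le hb
    exact Submodule.eq_of_le_of_finrank_le hle (hmin _ hsA)
  have huniv : T = univ := IsClopen.eq_univ ⟨hclosed, hopen⟩ ⟨0, by simpa [hT] using hzA⟩
  have h1 : (1 : ℝ) ∈ T := huniv ▸ mem_univ _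
  simpa [hT, hd] using h1

/-- Near a point `x` of `U`, any other point `p` of `U` has the nonzero vector `p - x` in `strat X p
⊓ U`. So each point has a neighbourhood with at most one point of the set, and compactness applies.
-/
theorem finite_strat_inf_eq_bot (hX : LocallyConic X) (U : Submodule ℝ E) {K : Set E}
    (hK : IsCompact K) : {p ∈ K | p ∈ U ∧ strat X p ⊓ U = ⊥}.Finite := by
  have key : ({p | p ∈ U ∧ strat X p ⊓ U = ⊥} ∩ K).Finite := by
    refine hK.induction_on (p := fun s => ({p | p ∈ U ∧ strat X p ⊓ U = ⊥} ∩ s).Finite)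
      (by simp) (fun s t hst ht => ht.subset (inter_subset_inter_right _ hst))
      (fun s t hs ht => by rw [inter_union_distrib_left]; exact hs.union ht) ?_
    intro x _
    have hx : ∃ N ∈ 𝓝 x, ({p | p ∈ U ∧ strat X p ⊓ U = ⊥} ∩ N).Subsingleton := by
      by_cases hxU : x ∈ U
      · obtain ⟨r, hr, hc⟩ := hX x
        refine ⟨ball x r, ball_mem_nhds x hr, ?_⟩
        have : ∀ p, (p ∈ U ∧ strat X p ⊓ U = ⊥) → p ∈ ball x r → p = x := by
          rintro p ⟨hpU, hp⟩ hpb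
          have h1 : p - x ∈ strat X p ⊓ U := ⟨hc.sub_mem_strat hX hpb, U.sub_mem hpU hxU⟩
          rw [hp, Submodule.mem_bot, sub_eq_zero] at h1
          exact h1
        rintro p ⟨hp, hpb⟩ q ⟨hq, hqb⟩
        rw [this p hp hpb, this q hq hqb]
      · refine ⟨(U : Set E)ᶜ, U.closed_of_finiteDimensional.isOpen_compl.mem_nhds hxU, ?_⟩
        rintro p ⟨hp, hpb⟩
        exact absurd hp.1 hpb
    obtain ⟨N, hN, hs⟩ := hx
    exact ⟨N, mem_nhdsWithin_of_mem_nhds hN, hs.finite⟩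
  refine key.subset ?_
  rintro p ⟨h1, h2⟩
  exact ⟨h2, h1⟩

/-- Finiteness of the flats of `X`, given a finite family of subspaces that contains a complement
of every subspace, such that the points that are singular in the section by any of them form a
bounded set. -/
theorem finite_range_flat (hX : LocallyConic X) {ι : Type*} [Finite ι] (U : ι → Submodule ℝ E)
    (hU : ∀ V : Submodule ℝ E, ∃ i, IsCompl V (U i)) (R : ℝ)
    (hR : ∀ i, ∀ p ∈ U i, IsCompl (strat X p) (U i) → ‖p‖ ≤ R) :
    (range (flat X)).Finite := by
  set P : Set E := ⋃ i, {p ∈ closedBall (0 : E) R | p ∈ U i ∧ strat X p ⊓ U i = ⊥} with hP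
  have hPfin : P.Finite :=
    finite_iUnion fun i => finite_strat_inf_eq_bot hX (U i) (isCompact_closedBall 0 R)
  choose N hN hNfin using exists_nhds_finite_flats hX
  refine (hPfin.biUnion fun p _ => hNfin p).subset ?_
  -- The minimal flat through `z` meets the complement `U i` in a point `p` of the finite set `P`,
  -- and the flat of `x` occurs arbitrarily close to `p`. Hence it is among the finitely many flats
  -- near `p`.
  rintro _ ⟨x, rfl⟩
  obtain ⟨z, hz⟩ := exists_minimal_flat hX x
  obtain ⟨i, hi⟩ := hU (strat X z)
  obtain ⟨v, hv, p, hp, hvp⟩ : ∃ v ∈ strat X z, ∃ p ∈ U i, v + p = z := by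
    have : z ∈ strat X z ⊔ U i := by rw [hi.sup_eq_top]; trivial
    exact Submodule.mem_sup.1 this
  obtain ⟨hs, hcl⟩ := hz p (by
    have : p - z = -v := by rw [← hvp]; abel
    rw [this]; exact (strat X z).neg_mem hv)
  have hpP : p ∈ P := by
    refine mem_iUnion.2 ⟨i, ?_, hp, ?_⟩
    · rw [mem_closedBall_zero_iff]
      exact hR i p hp (hs ▸ hi)
    · rw [hs]; exact hi.inf_eq_bot
  obtain ⟨y, hy, hyN⟩ := ((mem_closure_iff_frequently.1 hcl).and_eventually (hN p)).exists
  exact mem_biUnion hpP ⟨y, hyN, hy⟩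

end Finiteness

open Filter Topology Set Metric

/-! ### From the ratios 1/2 and 1/3 to all ratios -/

section Scaling

/-- Makes the group generated by `log 2` and `log 3` dense in `ℝ`. A rational quotient would equate
a power of 3 with a positive power of 2, against parity. -/
theorem irrational_log_two_div_log_three : Irrational (Real.log 2 / Real.log 3) := by
  rintro ⟨q, hq⟩
  have h2 : 0 < Real.log 2 := Real.log_pos (by norm_num)
  have h3 : 0 < Real.log 3 := Real.log_pos (by norm_num)
  have hqpos : (0 : ℝ) < q := by rw [hq]; positivity
  have hqpos' : 0 < q := by exact_mod_cast hqpos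
  obtain ⟨m, hm⟩ : ∃ m : ℕ, q.num = m := ⟨q.num.toNat, by
    have := Rat.num_pos.2 hqpos'
    omega⟩
  have hden : (q.den : ℝ) ≠ 0 := by exact_mod_cast q.den_nz
  have h4 : (q : ℝ) = m / q.den := by
    have : ((q.num : ℝ)) / q.den = q := by exact_mod_cast Rat.num_div_den q
    rw [← this, hm]; simp
  rw [h4, div_eq_div_iff hden h3.ne'] at hq
  have h5 : Real.log (3 ^ m) = Real.log (2 ^ q.den) := by
    rw [Real.log_pow, Real.log_pow]; linarith
  have h6 : (3 : ℝ) ^ m = 2 ^ q.den :=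
    Real.log_injOn_pos (by simp) (by simp) h5
  have h7 : 3 ^ m = 2 ^ q.den := by exact_mod_cast h6
  have h8 : Odd (3 ^ m) := Odd.pow (by decide)
  rw [h7] at h8
  exact (Nat.not_odd_iff_even.2 ((Nat.even_pow' q.den_nz).2 even_two)) h8

variable {T : Set ℝ}

/-- A set that is invariant under halving about every point, close to the point, is constant on
some interval. -/
theorem exists_ball_const
    (hloc : ∀ a ∈ Ioo (0 : ℝ) 1, ∃ r > 0, ∀ z, |z - a| < r → (z ∈ T ↔ (a + z) / 2 ∈ T)) :
    ∃ x ε, 0 < ε ∧ ball x ε ⊆ Ioo 0 1 ∧ ∀ a ∈ ball x ε, ∀ b ∈ ball x ε, a ∈ T ↔ b ∈ T := by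
  -- Baire category: `A k` collects the points whose radius of invariance is at least `1 / (k + 1)`.
  -- Their closures, together with the complement of `(0, 1)`, cover `ℝ`, so some `A k` is dense in
  -- an interval. Two points of `A k` close to each other are compared through their midpoint.
  set A : ℕ → Set ℝ := fun k => {a | a ∈ Ioo (0 : ℝ) 1 ∧
    ∀ z, |z - a| < 1 / (k + 1 : ℝ) → (z ∈ T ↔ (a + z) / 2 ∈ T)} with hA
  set f : ℕ → Set ℝ := fun k => closure (A k) ∪ (Iic 0 ∪ Ici 1) with hf
  have hfc : ∀ k, IsClosed (f k) := fun k => isClosed_closure.union (isClosed_Iic.union isClosed_Ici)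
  have hfU : ⋃ k, f k = univ := by
    refine eq_univ_of_forall fun a => mem_iUnion.2 ?_
    by_cases ha : a ∈ Ioo (0 : ℝ) 1
    · obtain ⟨r, hr, h⟩ := hloc a ha
      obtain ⟨k, hk⟩ := exists_nat_one_div_lt hr
      exact ⟨k, Or.inl (subset_closure ⟨ha, fun z hz => h z (hz.trans hk)⟩)⟩
    · refine ⟨0, Or.inr ?_⟩
      rw [mem_Ioo, not_and_or, not_lt, not_lt] at ha
      exact ha
  obtain ⟨x, hx1, hx2⟩ := (dense_iUnion_interior_of_closed hfc hfU).exists_mem_open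
    (isOpen_Ioo (a := (0 : ℝ)) (b := 1)) ⟨1 / 2, by norm_num, by norm_num⟩
  obtain ⟨k, hk⟩ := mem_iUnion.1 hx1
  have hopen : IsOpen (interior (f k) ∩ Ioo (0 : ℝ) 1) := isOpen_interior.inter isOpen_Ioo
  obtain ⟨ε, hε, hsub⟩ := Metric.isOpen_iff.1 hopen x ⟨hk, hx2⟩
  have hkpos : (0 : ℝ) < 1 / (k + 1) := by positivity
  set η := min ε (1 / (k + 1) / 2) with hη
  have hηpos : 0 < η := lt_min hε (by positivity)
  have hsub' : ball x η ⊆ interior (f k) ∩ Ioo (0 : ℝ) 1 :=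
    (ball_subset_ball (min_le_left _ _)).trans hsub
  have hcl : ball x η ⊆ closure (A k) := by
    intro b hb
    obtain ⟨h1, h2⟩ := hsub' hb
    rcases interior_subset h1 with h | h | h
    · exact h
    · exact absurd h2.1 (not_lt.2 h)
    · exact absurd h2.2 (not_lt.2 h)
  have hclose : ∀ a ∈ ball x η, ∀ b ∈ ball x η, |b - a| < 1 / (k + 1 : ℝ) := by
    intro a ha b hb
    rw [mem_ball, Real.dist_eq] at ha hb
    have h1 : η ≤ 1 / (k + 1) / 2 := min_le_right _ _
    have h2 := abs_sub_le b x a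
    rw [abs_sub_comm x a] at h2
    linarith
  have hAA : ∀ a ∈ A k, a ∈ ball x η → ∀ b ∈ A k, b ∈ ball x η → (a ∈ T ↔ b ∈ T) := by
    intro a ha ha' b hb hb'
    rw [hb.2 a (hclose b hb' a ha'), ha.2 b (hclose a ha' b hb'), add_comm]
  -- A point `b` outside `A k` has its own radius `r`, perhaps tiny; a point of `A k` within `r` of
  -- `b` can still be compared with `b` through the midpoint.
  have hex : ∀ b ∈ ball x η, ∃ a ∈ A k, a ∈ ball x η ∧ (a ∈ T ↔ b ∈ T) := by
    intro b hb
    obtain ⟨r, hr, h⟩ := hloc b (hsub' hb).2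
    obtain ⟨a, ⟨ha1, ha2⟩, ha3⟩ := mem_closure_iff.1 (hcl hb) (ball x η ∩ ball b r)
      (isOpen_ball.inter isOpen_ball) ⟨hb, mem_ball_self hr⟩
    refine ⟨a, ha3, ha1, ?_⟩
    rw [mem_ball, Real.dist_eq] at ha2
    rw [h a ha2, ha3.2 b (hclose a ha1 b hb), add_comm]
  refine ⟨x, η, hηpos, fun b hb => (hsub' hb).2, fun a ha b hb => ?_⟩
  obtain ⟨a', h1, h2, h3⟩ := hex a ha
  obtain ⟨b', h4, h5, h6⟩ := hex b hb
  rw [← h3, ← h6]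
  exact hAA a' h1 h2 b' h4 h5

/-- Some interval of constancy exists, and the dense set of factors `2 ^ i * 3 ^ j` moves any point
of `(0, 1)`, with a neighbourhood, into it. Hence membership is locally constant on a connected
interval. -/
theorem mem_iff_of_scaling
    (h2 : ∀ t ∈ Ioc (0 : ℝ) 1, (t ∈ T ↔ t / 2 ∈ T)) (h3 : ∀ t ∈ Ioc (0 : ℝ) 1, (t ∈ T ↔ t / 3 ∈ T))
    (hloc : ∀ a ∈ Ioo (0 : ℝ) 1, ∃ r > 0, ∀ z, |z - a| < r → (z ∈ T ↔ (a + z) / 2 ∈ T))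
    {s t : ℝ} (hs : s ∈ Ioc (0 : ℝ) 1) (ht : t ∈ Ioc (0 : ℝ) 1) : s ∈ T ↔ t ∈ T := by
  have hdown2 : ∀ (m : ℕ), ∀ t ∈ Ioc (0 : ℝ) 1, t / 2 ^ m ∈ Ioc (0 : ℝ) 1 ∧
      (t ∈ T ↔ t / 2 ^ m ∈ T) := by
    intro m
    induction m with
    | zero => intro t ht; simpa using ht
    | succ m ih =>
      intro t ht
      obtain ⟨h4, h5⟩ := ih t ht
      have e : t / 2 ^ (m + 1) = t / 2 ^ m / 2 := by rw [pow_succ, div_div]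
      rw [e]
      exact ⟨⟨by linarith [h4.1], by linarith [h4.1, h4.2]⟩, h5.trans (h2 _ h4)⟩
  have hdown3 : ∀ (m : ℕ), ∀ t ∈ Ioc (0 : ℝ) 1, t / 3 ^ m ∈ Ioc (0 : ℝ) 1 ∧
      (t ∈ T ↔ t / 3 ^ m ∈ T) := by
    intro m
    induction m with
    | zero => intro t ht; simpa using ht
    | succ m ih =>
      intro t ht
      obtain ⟨h4, h5⟩ := ih t ht
      have e : t / 3 ^ (m + 1) = t / 3 ^ m / 3 := by rw [pow_succ, div_div]
      rw [e]
      exact ⟨⟨by linarith [h4.1], by linarith [h4.1, h4.2]⟩, h5.trans (h3 _ h4)⟩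
  have hdown : ∀ (m k : ℕ), ∀ t ∈ Ioc (0 : ℝ) 1, (t ∈ T ↔ t / 2 ^ m / 3 ^ k ∈ T) :=
    fun m k t ht => ((hdown2 m t ht).2).trans (hdown3 k _ (hdown2 m t ht).1).2
  have hscale : ∀ (i j : ℤ), ∀ t ∈ Ioc (0 : ℝ) 1, t * (2 ^ i * 3 ^ j) ∈ Ioc (0 : ℝ) 1 →
      (t ∈ T ↔ t * (2 ^ i * 3 ^ j) ∈ T) := by
    intro i j t ht ht'
    -- Multiplying step by step could leave `(0, 1]`, so both points are divided down to a common
    -- point: the factors with positive exponents are removed from one, those with negative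
    -- exponents from the other.
    rw [hdown i.toNat j.toNat _ ht', hdown (-i).toNat (-j).toNat t ht]
    congr! 1
    have e : ∀ (c : ℝ) (i : ℤ), c ≠ 0 → c ^ i = c ^ i.toNat / c ^ (-i).toNat := by
      intro c i hc
      have : i = (i.toNat : ℤ) - ((-i).toNat : ℤ) := by omega
      conv_lhs => rw [this]
      rw [zpow_sub₀ hc, zpow_natCast, zpow_natCast]
    rw [e 2 i two_ne_zero, e 3 j three_ne_zero]
    field_simp
  obtain ⟨x, ε, hε, hsub, hconst⟩ := exists_ball_const hloc
  have hloc' : ∀ t₀ ∈ Ioo (0 : ℝ) 1, ∀ᶠ t in 𝓝 t₀, (t ∈ T ↔ t₀ ∈ T) := by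
    intro t₀ ht₀
    have hx : x ∈ Ioo (0 : ℝ) 1 := hsub (mem_ball_self hε)
    have hdense := dense_addSubgroupClosure_pair_iff.2 irrational_log_two_div_log_three
    have hc : ContinuousAt (fun g : ℝ => t₀ * Real.exp g) (Real.log (x / t₀)) := by fun_prop
    have hopen : IsOpen ((fun g : ℝ => t₀ * Real.exp g) ⁻¹' ball x ε) :=
      isOpen_ball.preimage (by fun_prop)
    obtain ⟨g, hg1, hg2⟩ := hdense.exists_mem_open hopen ⟨Real.log (x / t₀), by
      rw [mem_preimage, Real.exp_log (div_pos hx.1 ht₀.1), mul_div_cancel₀ _ ht₀.1.ne']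
      exact mem_ball_self hε⟩
    obtain ⟨i, j, rfl⟩ := AddSubgroup.mem_closure_pair.1 hg1
    have hexp : Real.exp (i • Real.log 2 + j • Real.log 3) = 2 ^ i * 3 ^ j := by
      rw [Real.exp_add, zsmul_eq_mul, zsmul_eq_mul, mul_comm (i : ℝ), mul_comm (j : ℝ),
        ← Real.rpow_def_of_pos two_pos, ← Real.rpow_def_of_pos three_pos, Real.rpow_intCast,
        Real.rpow_intCast]
    rw [mem_preimage, hexp] at hg2
    have hc2 : Continuous fun t : ℝ => t * ((2 : ℝ) ^ i * 3 ^ j) := by fun_prop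
    filter_upwards [hc2.continuousAt.preimage_mem_nhds (isOpen_ball.mem_nhds hg2),
      Ioo_mem_nhds ht₀.1 ht₀.2] with t h4 h5
    rw [hscale i j t (Ioo_subset_Ioc_self h5) (Ioo_subset_Ioc_self (hsub h4)),
      hscale i j t₀ (Ioo_subset_Ioc_self ht₀) (Ioo_subset_Ioc_self (hsub hg2))]
    exact hconst _ h4 _ hg2
  have hIoo : ∀ s ∈ Ioo (0 : ℝ) 1, ∀ t ∈ Ioo (0 : ℝ) 1, (s ∈ T ↔ t ∈ T) := by
    intro s hs t ht
    have : PreconnectedSpace (Ioo (0 : ℝ) 1) := Subtype.preconnectedSpace isPreconnected_Ioo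
    have hl : IsLocallyConstant (fun s : Ioo (0 : ℝ) 1 => (s : ℝ) ∈ T) := by
      rw [IsLocallyConstant.iff_eventually_eq]
      intro s
      filter_upwards [continuous_subtype_val.continuousAt.eventually (hloc' s s.2)] with s' hs'
      exact propext hs'
    exact iff_of_eq (hl.apply_eq_of_preconnectedSpace ⟨s, hs⟩ ⟨t, ht⟩)
  -- Halving moves the endpoint `1` into the open interval.
  rw [h2 s hs, h2 t ht]
  exact hIoo _ ⟨by linarith [hs.1], by linarith [hs.2]⟩ _ ⟨by linarith [ht.1], by linarith [ht.2]⟩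

end Scaling

/-! ### The criterion and its geometric consequences -/

section Criterion

variable {n : ℕ}

/-- `|x j - y j| < r j` for every coordinate `j`. -/
def Near (x y r : Fin n → ℝ) : Prop := ∀ j, x j < y j + r j ∧ y j < x j + r j

/-- The coordinates at which `e` does not vanish are zero in `x`. -/
def Disj (e x : Fin n → ℝ) : Prop := ∀ j, e j = 0 ∨ x j = 0

/-- Near every point, `X` is invariant under scaling by `1 / 2` and `1 / 3` about the point. -/
def ScalingCriterion (X : Set (Fin n → ℝ)) : Prop :=
  ∀ x, ∃ r, (∀ j, 0 < r j) ∧ ∀ y, Near x y r → ∀ z,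
    (z + z = x + y → (y ∈ X ↔ z ∈ X)) ∧ (z + z + z = x + x + y → (y ∈ X ↔ z ∈ X))

/-- In the section of `X` by a coordinate subspace, all points outside some box have arbitrarily
small local periods. -/
def SectionCriterion (X : Set (Fin n → ℝ)) : Prop :=
  ∀ e, ∃ R, ∀ x, Disj e x → Near 0 x R ∨ ∃ s : Fin n → ℝ, (∀ j, 0 < s j) ∧
    ∀ r : Fin n → ℝ, (∀ j, 0 < r j) → (∀ j, r j < s j) → ∃ v, v ≠ 0 ∧ Disj e v ∧ Near 0 v r ∧
      ∀ y, Disj e y → Near x y r → (y ∈ X ↔ y + v ∈ X)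

/-- Radii are vectors in the criterion because its formula quantifies only over vectors of `ℝⁿ`;
constant vectors recover balls in the sup norm. -/
theorem near_const_iff {x y : Fin n → ℝ} {δ : ℝ} (hδ : 0 < δ) :
    Near x y (fun _ => δ) ↔ y ∈ ball x δ := by
  rw [mem_ball, dist_pi_lt_iff hδ, Near]
  refine forall_congr' fun j => ?_
  rw [Real.dist_eq, abs_lt]
  constructor <;> rintro ⟨h1, h2⟩ <;> constructor <;> linarith

theorem exists_pos_lt (r : Fin n → ℝ) (hr : ∀ j, 0 < r j) : ∃ δ > 0, ∀ j, δ < r j := by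
  have h : ∀ᶠ δ in 𝓝[>] (0 : ℝ), ∀ j, δ < r j :=
    eventually_all.2 fun j => nhdsWithin_le_nhds (Iio_mem_nhds (hr j))
  obtain ⟨δ, h1, h2⟩ := ((eventually_mem_nhdsWithin (a := (0 : ℝ)) (s := Ioi 0)).and h).exists
  exact ⟨δ, h1, h2⟩

theorem Near.mono {x y r s : Fin n → ℝ} (h : Near x y r) (hrs : ∀ j, r j ≤ s j) : Near x y s :=
  fun j => ⟨by linarith [(h j).1, hrs j], by linarith [(h j).2, hrs j]⟩

theorem ScalingCriterion.locallyConic {X : Set (Fin n → ℝ)} (h : ScalingCriterion X) :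
    LocallyConic X := by
  have hball : ∀ x, ∃ δ > 0, ∀ y ∈ ball x δ, ∀ z,
      (z + z = x + y → (y ∈ X ↔ z ∈ X)) ∧ (z + z + z = x + x + y → (y ∈ X ↔ z ∈ X)) := by
    intro x
    obtain ⟨r, hr, hx⟩ := h x
    obtain ⟨δ, hδ, hlt⟩ := exists_pos_lt r hr
    exact ⟨δ, hδ, fun y hy => hx y (((near_const_iff hδ).2 hy).mono fun j => (hlt j).le)⟩
  intro x
  obtain ⟨δ, hδ, hx⟩ := hball x
  refine ⟨δ, hδ, fun y hy t ht => ?_⟩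
  set T : Set ℝ := {t | x + t • (y - x) ∈ X} with hT
  have hmem : ∀ t ∈ Ioc (0 : ℝ) 1, x + t • (y - x) ∈ ball x δ := by
    intro t ht
    rw [mem_ball, dist_eq_norm] at hy ⊢
    rw [add_sub_cancel_left, norm_smul, Real.norm_of_nonneg ht.1.le]
    exact (mul_le_of_le_one_left (norm_nonneg _) ht.2).trans_lt hy
  have key := mem_iff_of_scaling (T := T) (s := 1) (t := t) ?_ ?_ ?_ (by simp) ht
  · simpa [hT] using key
  · intro t ht
    refine (hx _ (hmem t ht) _).1 ?_
    ext j; simp; ring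
  · intro t ht
    refine (hx _ (hmem t ht) _).2 ?_
    ext j; simp; ring
  -- Halving about the interior point of parameter `a` on the segment is the criterion at that
  -- point; the `+ 1` keeps the divisor positive when `y = x`.
  · intro a ha
    obtain ⟨δ', hδ', ha'⟩ := hball (x + a • (y - x))
    have hpos : 0 < ‖y - x‖ + 1 := by positivity
    refine ⟨δ' / (‖y - x‖ + 1), by positivity, fun z hz => ?_⟩
    refine (ha' _ ?_ _).1 ?_
    · rw [mem_ball, dist_eq_norm, add_sub_add_left_eq_sub, ← sub_smul, norm_smul, Real.norm_eq_abs]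
      rw [lt_div_iff₀ hpos] at hz
      refine lt_of_le_of_lt ?_ hz
      gcongr
      linarith
    · ext j; simp; ring

/-- The subspace of the vectors that vanish at the coordinates in `s`. -/
def coordSubspace (s : Finset (Fin n)) : Submodule ℝ (Fin n → ℝ) where
  carrier := {x | ∀ j ∈ s, x j = 0}
  zero_mem' := by simp
  add_mem' := by
    intro a b ha hb j hj
    simp [ha j hj, hb j hj]
  smul_mem' := by
    intro c a ha j hj
    simp [ha j hj]

theorem mem_coordSubspace {s : Finset (Fin n)} {x : Fin n → ℝ} :
    x ∈ coordSubspace s ↔ ∀ j ∈ s, x j = 0 := Iff.rfl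

/-- Take `s` minimal such that its coordinate subspace meets `V` trivially. Dropping `j` from `s`
yields a vector of `V` whose only nonzero coordinate within `s` is the `j`-th, so the `j`-th unit
vector lies in the sum. -/
theorem exists_isCompl_coordSubspace (V : Submodule ℝ (Fin n → ℝ)) :
    ∃ s : Finset (Fin n), IsCompl V (coordSubspace s) := by
  classical
  have hne : ∃ s : Finset (Fin n), V ⊓ coordSubspace s = ⊥ := by
    refine ⟨Finset.univ, ?_⟩
    rw [eq_bot_iff]
    rintro x ⟨-, hx⟩
    ext j
    simpa using hx j (Finset.mem_univ j)
  obtain ⟨s, hs, hmin⟩ : ∃ s : Finset (Fin n), V ⊓ coordSubspace s = ⊥ ∧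
      ∀ t ⊂ s, V ⊓ coordSubspace t ≠ ⊥ := by
    obtain ⟨s, hs⟩ := exists_minimal_of_wellFoundedLT (fun s => V ⊓ coordSubspace s = ⊥) hne
    exact ⟨s, hs.prop, fun t ht h => hs.not_prop_of_lt ht h⟩
  refine ⟨s, disjoint_iff.2 hs, codisjoint_iff.2 ?_⟩
  have hsingle : ∀ j, Pi.single j (1 : ℝ) ∈ V ⊔ coordSubspace s := by
    intro j
    by_cases hj : j ∈ s
    · obtain ⟨v, hv, hv0⟩ := Submodule.exists_mem_ne_zero_of_ne_bot
        (hmin _ (Finset.erase_ssubset hj))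
      have hvj : v j ≠ 0 := by
        intro h0
        apply hv0
        have : v ∈ V ⊓ coordSubspace s := by
          refine ⟨hv.1, fun i hi => ?_⟩
          by_cases hij : i = j
          · rw [hij, h0]
          · exact hv.2 i (Finset.mem_erase.2 ⟨hij, hi⟩)
        rw [hs] at this
        simpa using this
      have hu : v j • Pi.single j (1 : ℝ) - v ∈ coordSubspace s := by
        intro i hi
        by_cases hij : i = j
        · subst hij; simp
        · have := hv.2 i (Finset.mem_erase.2 ⟨hij, hi⟩)
          simp [hij, this]
      have h1 : v j • Pi.single j (1 : ℝ) ∈ V ⊔ coordSubspace s := by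
        have := Submodule.add_mem_sup hv.1 hu
        simpa using this
      have := (V ⊔ coordSubspace s).smul_mem (v j)⁻¹ h1
      rwa [smul_smul, inv_mul_cancel₀ hvj, one_smul] at this
    · refine Submodule.mem_sup_right fun i hi => ?_
      have : i ≠ j := fun h => hj (h ▸ hi)
      simp [this]
  rw [eq_top_iff]
  intro x _
  rw [pi_eq_sum_univ' x]
  refine Submodule.sum_mem _ fun j _ => Submodule.smul_mem _ _ ?_
  convert! hsingle j using 1

/-- Suppose `strat X p` is complementary to a coordinate subspace. Since `X` is invariant along
`strat X p` near `p`, a small local period of the section at `p` is a local period of `X`, hence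
lies in `strat X p`, hence is zero. So `p` must lie in the box of the criterion. -/
theorem SectionCriterion.finite_range_flat {X : Set (Fin n → ℝ)} (h : SectionCriterion X)
    (hX : LocallyConic X) : (range (flat X)).Finite := by
  classical
  have key : ∀ s : Finset (Fin n), ∃ R : ℝ, ∀ p ∈ coordSubspace s,
      IsCompl (strat X p) (coordSubspace s) → ‖p‖ ≤ R := by
    intro s
    -- The support of `e` encodes the set of coordinates; a quantifier over vectors thus ranges over
    -- all coordinate subspaces, uniformly in `n`.
    set e : Fin n → ℝ := fun j => if j ∈ s then 1 else 0 with he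
    have hdisj : ∀ x, Disj e x ↔ x ∈ coordSubspace s := by
      intro x
      rw [mem_coordSubspace]
      refine forall_congr' fun j => ?_
      by_cases hj : j ∈ s <;> simp [he, hj]
    obtain ⟨R, hR⟩ := h e
    refine ⟨∑ j, |R j|, fun p hp hc => ?_⟩
    rcases hR p ((hdisj p).2 hp) with h1 | ⟨s', hs', h1⟩
    · refine (pi_norm_le_iff_of_nonneg (Finset.sum_nonneg fun j _ => abs_nonneg _)).2 fun j => ?_
      have h2 : |p j| ≤ |R j| := by
        have h3 := h1 j
        simp only [Pi.zero_apply, zero_add] at h3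
        refine le_trans ?_ (le_abs_self _)
        rw [abs_le]; constructor <;> linarith
      exact h2.trans (Finset.single_le_sum (f := fun j => |R j|) (fun j _ => abs_nonneg _)
        (Finset.mem_univ j))
    exfalso
    obtain ⟨r, hr, hcone⟩ := hX p
    obtain ⟨δ, hδ, hlt⟩ := exists_pos_lt (fun j => min (s' j) (r / 4))
      (fun j => lt_min (hs' j) (by linarith))
    obtain ⟨η, hη, hηδ, hηr'⟩ : ∃ η > 0, η ≤ δ ∧ η ≤ r / 4 :=
      ⟨min δ (r / 4), lt_min hδ (by linarith), min_le_left _ _, min_le_right _ _⟩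
    have hηlt : ∀ j, η < s' j := fun j => hηδ.trans_lt ((hlt j).trans_le (min_le_left _ _))
    obtain ⟨v, hv0, hve, hvr, hvX⟩ := h1 (fun _ => η) (fun _ => hη) hηlt
    rw [near_const_iff hη, mem_ball_zero_iff] at hvr
    rw [hdisj] at hve
    -- The projection onto the coordinate subspace along `strat X p`; it moves a point near `p` into
    -- the section without changing membership in `X`.
    set q : (Fin n → ℝ) →ₗ[ℝ] (Fin n → ℝ) := (coordSubspace s).subtype ∘ₗ
      (coordSubspace s).projectionOnto (strat X p) hc.symm with hq
    have hqc : Continuous q := q.continuous_of_finiteDimensional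
    have hqU : ∀ w, q w ∈ coordSubspace s := fun w => by simp [hq]
    have hqV : ∀ w, w - q w ∈ strat X p := by
      intro w
      have : w - q w ∈ LinearMap.ker ((coordSubspace s).projectionOnto (strat X p) hc.symm) := by
        rw [LinearMap.mem_ker, map_sub, sub_eq_zero]
        exact (Submodule.projectionOnto_apply_left hc.symm _).symm
      simpa using this
    obtain ⟨δ', hδ', hqδ⟩ : ∃ δ' > 0, ∀ w, ‖w‖ < δ' → ‖q w‖ < η := by
      have := Metric.continuousAt_iff.1 (hqc.continuousAt (x := 0)) η hη
      simpa [dist_eq_norm] using this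
    have hmem : v ∈ strat X p := by
      refine hcone.mem_strat_of_shift (δ := min δ' (r / 4)) (lt_min hδ' (by linarith)) ?_ ?_
      · have := min_le_right δ' (r / 4)
        linarith
      · intro y hy
        rw [mem_ball, dist_eq_norm] at hy
        have hw1 : ‖y - p‖ < r / 4 := hy.trans_le (min_le_right _ _)
        have hw2 : ‖q (y - p)‖ < η := hqδ _ (hy.trans_le (min_le_left _ _))
        have b1 : p + q (y - p) ∈ ball p r := by
          rw [mem_ball, dist_eq_norm, add_sub_cancel_left]; linarith
        have b2 : y ∈ ball p r := by rw [mem_ball, dist_eq_norm]; linarith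
        have b3 : p + q (y - p) + v ∈ ball p r := by
          rw [mem_ball, dist_eq_norm, add_assoc, add_sub_cancel_left]
          linarith [norm_add_le (q (y - p)) v]
        have b4 : y + v ∈ ball p r := by
          rw [mem_ball, dist_eq_norm, add_sub_right_comm]
          linarith [norm_add_le (y - p) v]
        have e1 : p + q (y - p) + (y - p - q (y - p)) = y := by abel
        have e2 : p + q (y - p) + v + (y - p - q (y - p)) = y + v := by abel
        have i1 := hcone.iff_add_of_mem_strat (hqV (y - p)) b1 (by rwa [e1])
        have i2 := hcone.iff_add_of_mem_strat (hqV (y - p)) b3 (by rwa [e2])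
        rw [e1] at i1
        rw [e2] at i2
        rw [← i1, ← i2]
        refine hvX _ ((hdisj _).2 ((coordSubspace s).add_mem hp (hqU _))) ?_
        rw [near_const_iff hη, mem_ball, dist_eq_norm, add_sub_cancel_left]
        exact hw2
    have : v ∈ strat X p ⊓ coordSubspace s := ⟨hmem, hve⟩
    rw [hc.inf_eq_bot] at this
    exact hv0 (by simpa using this)
  choose R hR using key
  obtain ⟨R', hR'⟩ := Finite.exists_le R
  exact RealAdd.finite_range_flat hX coordSubspace exists_isCompl_coordSubspace R'
    fun s p hp hc => (hR s p hp hc).trans (hR' s)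

end Criterion

open Filter Topology Set Metric

/-! ### Subspaces with rational equations -/

section Rational

variable {n : ℕ}

/-- A real subspace that is spanned by its rational vectors is cut out by rational equations. -/
theorem exists_rat_matrix (V : Submodule ℝ (Fin n → ℝ))
    (hV : V ≤ Submodule.span ℝ {v | v ∈ V ∧ ∃ q : Fin n → ℚ, v = fun i => (q i : ℝ)}) :
    ∃ M : Fin n → Fin n → ℚ, ∀ x, x ∈ V ↔ ∀ i, ∑ j, (M i j : ℝ) * x j = 0 := by
  let Vq : Submodule ℚ (Fin n → ℚ) :=
    { carrier := {q | (fun i => (q i : ℝ)) ∈ V}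
      zero_mem' := by
        have : (fun i => (((0 : Fin n → ℚ) i : ℚ) : ℝ)) = 0 := by ext; simp
        rw [mem_ofPred_eq, this]
        exact V.zero_mem
      add_mem' := by
        intro a b ha hb
        have : (fun i => (((a + b) i : ℚ) : ℝ)) = (fun i => (a i : ℝ)) + fun i => (b i : ℝ) := by
          ext; simp
        rw [mem_ofPred_eq, this]
        exact V.add_mem ha hb
      smul_mem' := by
        intro c a ha
        have : (fun i => (((c • a) i : ℚ) : ℝ)) = (c : ℝ) • fun i => (a i : ℝ) := by
          ext; simp
        rw [mem_ofPred_eq, this]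
        exact V.smul_mem _ ha }
  obtain ⟨W, hW⟩ := Submodule.exists_isCompl Vq
  -- The rational projection with kernel `Vq`; its matrix supplies the equations. A real `x` that it
  -- kills is the combination of the vectors `e_j - f e_j`, which lie in `Vq`, with coefficients `x
  -- j`.
  let f : (Fin n → ℚ) →ₗ[ℚ] (Fin n → ℚ) := W.subtype ∘ₗ W.projectionOnto Vq hW.symm
  have hf0 : ∀ q ∈ Vq, f q = 0 := by
    intro q hq
    have : W.projectionOnto Vq hW.symm q = 0 :=
      (Submodule.projectionOnto_apply_eq_zero_iff _).2 hq
    simp only [f, LinearMap.comp_apply, this, map_zero]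
  have hf1 : ∀ q, q - f q ∈ Vq := by
    intro q
    have : q - f q ∈ LinearMap.ker (W.projectionOnto Vq hW.symm) := by
      rw [LinearMap.mem_ker, map_sub, sub_eq_zero]
      exact (Submodule.projectionOnto_apply_left hW.symm _).symm
    simpa using this
  let A : Matrix (Fin n) (Fin n) ℚ := LinearMap.toMatrix' f
  have hfsum : ∀ q i, f q i = ∑ j, A i j * q j := by
    intro q i
    conv_lhs => rw [← LinearMap.toMatrix'_mulVec f q]
    rfl
  refine ⟨fun i j => A i j, fun x => ⟨fun hx => ?_, fun hx => ?_⟩⟩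
  · have h0 := hV hx
    clear hx
    induction h0 using Submodule.span_induction with
    | mem v hv =>
      obtain ⟨hv, q, rfl⟩ := hv
      intro i
      have h := hfsum q i
      rw [hf0 q hv, Pi.zero_apply] at h
      have h' : ((∑ j, A i j * q j : ℚ) : ℝ) = 0 := by rw [← h]; simp
      push_cast at h'
      exact h'
    | zero => simp
    | add a b ha' hb' ha hb =>
      intro i
      simp only [Pi.add_apply, mul_add, Finset.sum_add_distrib]
      rw [ha, hb, add_zero]
    | smul c a ha' ha =>
      intro i
      simp only [Pi.smul_apply, smul_eq_mul, mul_left_comm _ c, ← Finset.mul_sum]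
      rw [ha, mul_zero]
  · have hx' : x = ∑ j, x j • fun i => ((((Pi.single j 1 : Fin n → ℚ) - f (Pi.single j 1)) i : ℚ) : ℝ) := by
      ext i
      rw [Finset.sum_apply]
      have e : ∀ j, (x j • fun i => ((((Pi.single j 1 : Fin n → ℚ) - f (Pi.single j 1)) i : ℚ) : ℝ)) i =
          x j * (Pi.single j (1 : ℝ) : Fin n → ℝ) i - (A i j : ℝ) * x j := by
        intro j
        have h1 : f (Pi.single j 1) i = A i j := by
          rw [hfsum]; simp [Pi.single_apply]
        rw [Pi.smul_apply, Pi.sub_apply, h1, smul_eq_mul]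
        by_cases hij : i = j
        · subst hij; simp; ring
        · simp [hij]; ring
      rw [Finset.sum_congr rfl fun j _ => e j, Finset.sum_sub_distrib, hx i]
      simp [Pi.single_apply]
    rw [hx']
    exact V.sum_mem fun j _ => V.smul_mem _ (hf1 _)

end Rational

/-! ### Definability of rational sign conditions -/

section Definability

variable {β : Type}

/-- Affine forms with rational coefficients, as differences of terms. -/
def RatAff (f : (β → ℝ) → ℝ) : Prop :=
  ∃ N : ℕ, 0 < N ∧ ∃ t u : lang.Term β, ∀ x, (N : ℝ) * f x = t.realize x - u.realize x

/-- The symbol `+`. -/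
def addFunc : lang.Functions 2 := Func.add

/-- The symbol `1`. -/
def oneFunc : lang.Functions 0 := Func.one

/-- The symbol `<`. -/
def ltRel : lang.Relations 2 := Rel.lt

/-- The sum of two terms. -/
def addTerm (t u : lang.Term β) : lang.Term β := addFunc.apply₂ t u

/-- The term `1`. -/
def oneTerm : lang.Term β := Language.Constants.term oneFunc

@[simp] theorem realize_addTerm (t u : lang.Term β) (x : β → ℝ) :
    (addTerm t u).realize x = t.realize x + u.realize x := by
  rw [addTerm, Language.Term.realize_functions_apply₂]; rfl

@[simp] theorem realize_oneTerm (x : β → ℝ) : (oneTerm : lang.Term β).realize x = 1 := by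
  rw [oneTerm, Language.Term.realize_constants]; rfl

theorem exists_nsmul_term (t : lang.Term β) (k : ℕ) (hk : 0 < k) :
    ∃ u : lang.Term β, ∀ x : β → ℝ, u.realize x = k * t.realize x := by
  induction k, hk using Nat.le_induction with
  | base => exact ⟨t, by simp⟩
  | succ k _ ih =>
    obtain ⟨u, hu⟩ := ih
    refine ⟨addTerm u t, fun x => ?_⟩
    rw [realize_addTerm, hu]; push_cast; ring

/-- The language has neither `0` nor subtraction, so a summand `1` is added on both sides. -/
theorem RatAff.one : RatAff (fun _ : β → ℝ => 1) :=
  ⟨1, one_pos, addTerm oneTerm oneTerm, oneTerm, fun x => by simp⟩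

theorem RatAff.var (i : β) : RatAff (fun x : β → ℝ => x i) :=
  ⟨1, one_pos, addTerm (.var i) oneTerm, oneTerm, fun x => by simp⟩

theorem RatAff.add {f g : (β → ℝ) → ℝ} (hf : RatAff f) (hg : RatAff g) :
    RatAff fun x => f x + g x := by
  obtain ⟨N, hN, t, u, h⟩ := hf
  obtain ⟨N', hN', t', u', h'⟩ := hg
  obtain ⟨t1, h1⟩ := exists_nsmul_term t N' hN'
  obtain ⟨u1, h2⟩ := exists_nsmul_term u N' hN'
  obtain ⟨t2, h3⟩ := exists_nsmul_term t' N hN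
  obtain ⟨u2, h4⟩ := exists_nsmul_term u' N hN
  refine ⟨N * N', by positivity, addTerm t1 t2, addTerm u1 u2, fun x => ?_⟩
  rw [realize_addTerm, realize_addTerm, h1, h2, h3, h4]
  push_cast
  linear_combination (N' : ℝ) * h x + N * h' x

theorem RatAff.smul {f : (β → ℝ) → ℝ} (hf : RatAff f) (q : ℚ) : RatAff fun x => q * f x := by
  obtain ⟨N, hN, t, u, h⟩ := hf
  have hden : (q.den : ℝ) ≠ 0 := by exact_mod_cast q.den_nz
  have hq : (q : ℝ) * q.den = q.num := by exact_mod_cast Rat.mul_den_eq_num q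
  rcases lt_trichotomy q.num 0 with h0 | h0 | h0
  · have hpos : 0 < q.num.natAbs := Int.natAbs_pos.2 h0.ne
    have hc : (q.num : ℝ) = -(q.num.natAbs : ℝ) := by
      rw [Nat.cast_natAbs, abs_of_neg h0]; simp
    obtain ⟨t1, h1⟩ := exists_nsmul_term t _ hpos
    obtain ⟨u1, h2⟩ := exists_nsmul_term u _ hpos
    refine ⟨N * q.den, Nat.mul_pos hN q.den_pos, u1, t1, fun x => ?_⟩
    rw [h1, h2]
    push_cast
    linear_combination (N * f x) * hq + (N * f x) * hc - (q.num.natAbs : ℝ) * h x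
  · have : q = 0 := Rat.num_eq_zero.1 h0
    exact ⟨1, one_pos, oneTerm, oneTerm, fun x => by simp [this]⟩
  · have hpos : 0 < q.num.natAbs := Int.natAbs_pos.2 h0.ne'
    have hc : (q.num : ℝ) = (q.num.natAbs : ℝ) := by
      rw [Nat.cast_natAbs, abs_of_pos h0]
    obtain ⟨t1, h1⟩ := exists_nsmul_term t _ hpos
    obtain ⟨u1, h2⟩ := exists_nsmul_term u _ hpos
    refine ⟨N * q.den, Nat.mul_pos hN q.den_pos, t1, u1, fun x => ?_⟩
    rw [h1, h2]
    push_cast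
    linear_combination (N * f x) * hq + (N * f x) * hc + (q.num.natAbs : ℝ) * h x

theorem RatAff.const (q : ℚ) : RatAff (fun _ : β → ℝ => (q : ℝ)) := by
  simpa using RatAff.one.smul q

theorem RatAff.sub {f g : (β → ℝ) → ℝ} (hf : RatAff f) (hg : RatAff g) :
    RatAff fun x => f x - g x := by
  have := hf.add (hg.smul (-1))
  convert! this using 2
  push_cast; ring

theorem RatAff.sum {ι : Type*} (s : Finset ι) {f : ι → (β → ℝ) → ℝ} (hf : ∀ i, RatAff (f i)) :
    RatAff fun x => ∑ i ∈ s, f i x := by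
  classical
  induction s using Finset.induction with
  | empty => simpa using RatAff.const 0
  | insert a s ha ih =>
    simp only [Finset.sum_insert ha]
    exact (hf a).add ih

theorem RatAff.definable_pos {f : (β → ℝ) → ℝ} (hf : RatAff f) :
    (∅ : Set ℝ).Definable lang {x | 0 < f x} := by
  obtain ⟨N, hN, t, u, h⟩ := hf
  rw [empty_definable_iff]
  refine ⟨ltRel.formula₂ u t, ?_⟩
  ext x
  have hN' : (0 : ℝ) < N := by exact_mod_cast hN
  have e : (ltRel.formula₂ u t).Realize x ↔ u.realize x < t.realize x := by
    rw [Language.Formula.realize_rel₂]; rfl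
  rw [mem_ofPred_eq, mem_ofPred_eq, e, ← sub_pos (b := u.realize x), ← h,
    mul_pos_iff_of_pos_left hN']

theorem RatAff.definable_sign_eq {f : (β → ℝ) → ℝ} (hf : RatAff f) (σ : SignType) :
    (∅ : Set ℝ).Definable lang {x | SignType.sign (f x) = σ} := by
  have h1 : (∅ : Set ℝ).Definable lang {x | 0 < f x} := hf.definable_pos
  have h2 : (∅ : Set ℝ).Definable lang {x | f x < 0} := by
    have := (hf.smul (-1)).definable_pos
    simpa using this
  rcases σ with _ | _ | _
  · convert! (h1.union h2).compl using 1
    ext x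
    have : SignType.zero = 0 := rfl
    simp only [this, sign_eq_zero_iff, mem_ofPred_eq, mem_compl_iff, mem_union, not_or, not_lt]
    exact ⟨fun h => by simp [h], fun h => le_antisymm h.1 h.2⟩
  · convert! h2 using 1
    ext x
    simp [sign_eq_neg_one_iff]
  · convert! h1 using 1
    ext x
    simp [sign_eq_one_iff]

theorem definable_signs_mem {ι : Type*} [Finite ι] {f : ι → (β → ℝ) → ℝ} (hf : ∀ i, RatAff (f i))
    (S : Set (ι → SignType)) :
    (∅ : Set ℝ).Definable lang {x | (fun i => SignType.sign (f i x)) ∈ S} := by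
  have h := definable_iUnion_of_finite fun σ : S =>
    definable_iInter_of_finite fun i => (hf i).definable_sign_eq (σ.1 i)
  convert! h using 1
  ext x
  simp only [mem_ofPred_eq, mem_iUnion, mem_iInter, Subtype.exists, exists_prop]
  constructor
  · intro h; exact ⟨_, h, fun i => rfl⟩
  · rintro ⟨σ, hσ, h⟩
    rwa [funext h]

theorem definable_forall {L : Language} [L.Structure ℝ] {n : ℕ} {s : Set (β ⊕ Fin n → ℝ)}
    (hs : (∅ : Set ℝ).Definable L s) :
    (∅ : Set ℝ).Definable L {v : β → ℝ | ∀ y : Fin n → ℝ, Sum.elim v y ∈ s} := by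
  convert! (hs.compl.image_comp_sumInl_fin n).compl using 1
  ext v
  simp only [mem_ofPred_eq, mem_compl_iff, mem_image, not_exists, not_and]
  constructor
  · rintro h w hw rfl
    apply hw
    convert! h (w ∘ Sum.inr) using 1
    ext (i | i) <;> rfl
  · intro h y
    by_contra hy
    exact h _ hy rfl

theorem Definable.preimage_term {L : Language} [L.Structure ℝ] {α : Type} {s : Set (α → ℝ)}
    (hs : (∅ : Set ℝ).Definable L s) (t : α → L.Term β) :
    (∅ : Set ℝ).Definable L {v : β → ℝ | (fun i => (t i).realize v) ∈ s} := by
  rw [empty_definable_iff] at hs ⊢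
  obtain ⟨φ, rfl⟩ := hs
  refine ⟨Language.BoundedFormula.subst φ t, ?_⟩
  ext v
  exact (Language.BoundedFormula.realize_subst (φ := φ)).symm

end Definability

/-! ### Rational directions and offsets: sufficiency -/

section Main

variable {n : ℕ} {X : Set (Fin n → ℝ)}

theorem strat_eq_of_flat_eq {x y : Fin n → ℝ} (h : flat X x = flat X y) :
    strat X x = strat X y := by
  have key : ∀ {x y : Fin n → ℝ}, flat X x = flat X y → strat X x ≤ strat X y := by
    intro x y h v hv
    have h1 : x ∈ flat X y := by rw [← h]; simp [flat]
    have h2 : x + v ∈ flat X y := by rw [← h]; simpa [flat] using hv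
    have h3 := (strat X y).sub_mem h2 h1
    simpa using h3
  exact le_antisymm (key h) (key h.symm)

theorem exists_rat_near (x : Fin n → ℝ) {ε : ℝ} (hε : 0 < ε) :
    ∃ q : Fin n → ℚ, (fun i => (q i : ℝ)) ∈ ball x ε := by
  have h : ∀ i, ∃ q : ℚ, |(q : ℝ) - x i| < ε := by
    intro i
    obtain ⟨q, h1, h2⟩ := exists_rat_btwn (show x i - ε < x i + ε by linarith)
    exact ⟨q, abs_lt.2 ⟨by linarith, by linarith⟩⟩
  choose q hq using h
  refine ⟨q, ?_⟩
  rw [mem_ball, dist_pi_lt_iff hε]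
  exact hq

variable {L : Language} [L.Structure ℝ] (ι : lang →ᴸ L) [ι.IsExpansionOn ℝ]

include ι in
theorem definable_ball_rat (q : Fin n → ℚ) {ε : ℚ} (hε : 0 < ε) {γ : Type} (f : Fin n → γ) :
    (∅ : Set ℝ).Definable L {v : γ → ℝ | v ∘ f ∈ ball (fun i => (q i : ℝ)) (ε : ℝ)} := by
  have hε' : (0 : ℝ) < ε := by exact_mod_cast hε
  have h1 : ∀ j, (∅ : Set ℝ).Definable L {v : γ → ℝ | 0 < v (f j) - (q j - ε : ℚ)} := fun j =>
    ((RatAff.var (f j)).sub (RatAff.const (q j - ε))).definable_pos.map_expansion ι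
  have h2 : ∀ j, (∅ : Set ℝ).Definable L {v : γ → ℝ | 0 < (q j + ε : ℚ) - v (f j)} := fun j =>
    ((RatAff.const (q j + ε)).sub (RatAff.var (f j))).definable_pos.map_expansion ι
  convert! definable_iInter_of_finite fun j => (h1 j).inter (h2 j) using 1
  ext v
  rw [mem_ofPred_eq, mem_ball, dist_pi_lt_iff hε', mem_iInter]
  refine forall_congr' fun j => ?_
  simp only [Real.dist_eq, abs_lt, Function.comp_apply, mem_inter_iff, mem_ofPred_eq]
  push_cast
  constructor <;> rintro ⟨h1, h2⟩ <;> constructor <;> linarith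

include ι in
-- Near the apex of a cone, a small vector is a direction of invariance exactly if it is a period on
-- one fixed ball. No parameter is needed, since that ball may have a rational centre `q` near `x`:
-- its radius `2 * ε` makes it contain the `ε`-ball about `x`, and shifts by less than `ε` stay
-- within `4 * ε < r` of `x`.
theorem definable_strat_inter_ball (hX : LocallyConic X) (hdef : IsDefinable L X)
    (x : Fin n → ℝ) : ∃ ε : ℚ, 0 < ε ∧
      IsDefinable L ({v | v ∈ strat X x} ∩ ball 0 (ε : ℝ)) := by
  obtain ⟨r, hr, hc⟩ := hX x
  obtain ⟨ε, hε, hεr⟩ := exists_rat_btwn (show (0 : ℝ) < r / 4 by linarith)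
  have hε' : 0 < ε := by exact_mod_cast hε
  obtain ⟨q, hq⟩ := exists_rat_near x hε
  refine ⟨ε, hε', ?_⟩
  have d1 : (∅ : Set ℝ).Definable L
      {g : Fin n ⊕ Fin n → ℝ | g ∘ Sum.inr ∈ ball (fun i => (q i : ℝ)) ((2 * ε : ℚ) : ℝ)} :=
    definable_ball_rat ι q (by positivity) Sum.inr
  have d2 : (∅ : Set ℝ).Definable L {g : Fin n ⊕ Fin n → ℝ | g ∘ Sum.inr ∈ X} :=
    hdef.preimage_comp Sum.inr
  have d3 : (∅ : Set ℝ).Definable L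
      {g : Fin n ⊕ Fin n → ℝ | g ∘ Sum.inr + g ∘ Sum.inl ∈ X} := by
    convert! Definable.preimage_term hdef
      fun i => ι.onTerm (addTerm (.var (Sum.inr i)) (.var (Sum.inl i))) using 1
    ext g
    rw [mem_ofPred_eq, mem_ofPred_eq]
    congr! 1
    ext i
    simp
  have d4 : (∅ : Set ℝ).Definable L {g : Fin n ⊕ Fin n → ℝ |
      g ∘ Sum.inr ∈ ball (fun i => (q i : ℝ)) ((2 * ε : ℚ) : ℝ) →
        (g ∘ Sum.inr ∈ X ↔ g ∘ Sum.inr + g ∘ Sum.inl ∈ X)} := by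
    convert! d1.compl.union ((d2.inter d3).union (d2.compl.inter d3.compl)) using 1
    ext g
    simp only [mem_ofPred_eq, mem_union, mem_inter_iff, mem_compl_iff]
    tauto
  have d5 := definable_forall d4
  have d6 : (∅ : Set ℝ).Definable L {v : Fin n → ℝ | v ∘ id ∈ ball (fun _ => ((0 : ℚ) : ℝ)) (ε : ℝ)} :=
    definable_ball_rat ι 0 hε' id
  convert! d5.inter d6 using 1
  ext v
  have e0 : (fun _ : Fin n => ((0 : ℚ) : ℝ)) = 0 := by ext; simp
  simp only [mem_ofPred_eq, mem_inter_iff, Function.comp_id, e0]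
  refine and_congr_left fun hv => ?_
  rw [mem_ball_zero_iff] at hv
  have e1 : ∀ y : Fin n → ℝ, Sum.elim v y ∘ Sum.inr = y := fun y => rfl
  have e2 : ∀ y : Fin n → ℝ, Sum.elim v y ∘ Sum.inl = v := fun y => rfl
  simp only [e1, e2]
  push_cast
  constructor
  · intro h y hy
    have hy' : dist y x < 3 * ε := by
      have := dist_triangle y (fun i => (q i : ℝ)) x
      rw [mem_ball] at hq hy
      linarith
    refine hc.iff_add_of_mem_strat h (by rw [mem_ball]; linarith) ?_
    rw [dist_eq_norm] at hy'
    rw [mem_ball, dist_eq_norm]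
    have : y + v - x = (y - x) + v := by abel
    rw [this]
    linarith [norm_add_le (y - x) v]
  · intro h
    refine hc.mem_strat_of_shift hε (by linarith) fun y hy => h y ?_
    have := dist_triangle y x (fun i => (q i : ℝ))
    rw [mem_ball] at *
    rw [dist_comm] at hq
    linarith

include ι in
-- Intersecting the definable piece of `strat X x` with small rational balls shows that rational
-- vectors are dense in it; a linear span in finite dimension is closed.
theorem strat_le_span_rat (hrat : ∀ (n : ℕ) (X : Set (Fin n → ℝ)), IsDefinable L X → X.Nonempty →
      ∃ q : Fin n → ℚ, (fun i => (q i : ℝ)) ∈ X)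
    (hX : LocallyConic X) (hdef : IsDefinable L X) (x : Fin n → ℝ) :
    strat X x ≤ Submodule.span ℝ
      {v | v ∈ strat X x ∧ ∃ q : Fin n → ℚ, v = fun i => (q i : ℝ)} := by
  obtain ⟨ε, hε, hD⟩ := definable_strat_inter_ball ι hX hdef x
  have hε' : (0 : ℝ) < ε := by exact_mod_cast hε
  set W := Submodule.span ℝ {v | v ∈ strat X x ∧ ∃ q : Fin n → ℚ, v = fun i => (q i : ℝ)} with hW
  have hsmall : ∀ v ∈ strat X x, ‖v‖ < ε → v ∈ W := by
    intro v hv hvε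
    have hcl : v ∈ closure (W : Set (Fin n → ℝ)) := by
      rw [Metric.mem_closure_iff]
      intro η hη
      obtain ⟨η', hη'1, hη'2⟩ := exists_rat_btwn (show (0 : ℝ) < η / 2 by linarith)
      obtain ⟨p, hp⟩ := exists_rat_near v hη'1
      have hdef' := hD.inter (definable_ball_rat ι p (by exact_mod_cast hη'1 : 0 < η') id)
      obtain ⟨q, ⟨hq1, -⟩, hq2⟩ := hrat n _ hdef' ⟨v, ⟨hv, by simpa using hvε⟩, by
        rw [mem_ofPred_eq, Function.comp_id, mem_ball, dist_comm]; exact hp⟩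
      refine ⟨_, Submodule.subset_span ⟨hq1, q, rfl⟩, ?_⟩
      have h1 : dist (fun i => (q i : ℝ)) (fun i => (p i : ℝ)) < η' := hq2
      have h2 : dist (fun i => (p i : ℝ)) v < η' := hp
      rw [dist_comm]
      linarith [dist_triangle (fun i => (q i : ℝ)) (fun i => (p i : ℝ)) v]
    rwa [W.closed_of_finiteDimensional.closure_eq] at hcl
  intro v hv
  have hpos : 0 < ε / (‖v‖ + 1) := by positivity
  have h1 := hsmall (((ε : ℝ) / (‖v‖ + 1)) • v) ((strat X x).smul_mem _ hv) (by
    rw [norm_smul, Real.norm_of_nonneg hpos.le, div_mul_eq_mul_div, div_lt_iff₀ (by positivity)]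
    nlinarith [norm_nonneg v])
  exact (W.smul_mem_iff hpos.ne').1 h1

include ι in
/-- Sufficiency of the criterion. -/
theorem isDefinable_of_criterion
    (hrat : ∀ (n : ℕ) (X : Set (Fin n → ℝ)), IsDefinable L X → X.Nonempty →
      ∃ q : Fin n → ℚ, (fun i => (q i : ℝ)) ∈ X)
    (hdef : IsDefinable L X) (h1 : ScalingCriterion X) (h2 : SectionCriterion X) :
    IsDefinable lang X := by
  have hX := h1.locallyConic
  have : Finite (range (flat X)) := h2.finite_range_flat hX
  choose M hM using fun x => exists_rat_matrix _ (strat_le_span_rat ι hrat hX hdef x)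
  have hz : ∀ G : range (flat X), ∃ z, flat X z = G := fun G => G.2
  choose z hz using hz
  -- One affine form for each flat and each row of its equations: rational normal `a i`, real offset
  -- `b₀ i`.
  let I := Fin (Nat.card (range (flat X))) × Fin n
  let e : range (flat X) ≃ Fin (Nat.card (range (flat X))) := Finite.equivFin _
  let a : I → Fin n → ℚ := fun i => M (z (e.symm i.1)) i.2
  let b₀ : I → ℝ := fun i => ∑ j, (a i j : ℝ) * z (e.symm i.1) j
  let sg : (I → ℝ) → (Fin n → ℝ) → I → SignType := fun b x i =>
    SignType.sign (∑ j, (a i j : ℝ) * x j - b i)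
  -- At a point `w` of the segment, the forms of its flat vanish. A convex combination of two reals
  -- of equal sign vanishes only if the one at `x` or at `y` is zero, hence both are. So `y - x` is
  -- a direction of that flat, and `X` is constant along the segment.
  have hsep : ∀ x y, sg b₀ x = sg b₀ y → (x ∈ X ↔ y ∈ X) := by
    intro x y hxy
    refine mem_iff_of_sub_mem_strat fun s hs => ?_
    set w := x + s • (y - x) with hw
    set G : range (flat X) := ⟨flat X w, mem_range_self w⟩ with hG
    have hflat : flat X (z G) = flat X w := hz G
    rw [← strat_eq_of_flat_eq hflat, hM]
    intro i
    have hwz : w - z G ∈ strat X (z G) := by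
      have : w ∈ flat X (z G) := by rw [hflat]; simp [flat]
      exact this
    rw [hM] at hwz
    have e1 := hwz i
    have e2 := congrFun hxy (e G, i)
    simp only [sg, b₀, a, Equiv.symm_apply_apply] at e2
    have e3 : ∀ u v : Fin n → ℝ, ∑ j, (M (z G) i j : ℝ) * (u - v) j =
        ∑ j, (M (z G) i j : ℝ) * u j - ∑ j, (M (z G) i j : ℝ) * v j := by
      intro u v
      rw [← Finset.sum_sub_distrib]
      exact Finset.sum_congr rfl fun j _ => by rw [Pi.sub_apply, mul_sub]
    have e4 : ∑ j, (M (z G) i j : ℝ) * w j = ∑ j, (M (z G) i j : ℝ) * x j +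
        s * ∑ j, (M (z G) i j : ℝ) * (y - x) j := by
      rw [Finset.mul_sum, ← Finset.sum_add_distrib]
      refine Finset.sum_congr rfl fun j _ => ?_
      simp [hw]; ring
    rw [e3] at e1 e4 ⊢
    generalize (∑ j, (M (z G) i j : ℝ) * x j) = A at *
    generalize (∑ j, (M (z G) i j : ℝ) * y j) = B at *
    generalize (∑ j, (M (z G) i j : ℝ) * z G j) = C at *
    generalize (∑ j, (M (z G) i j : ℝ) * w j) = D at *
    obtain ⟨hs0, hs1⟩ := hs
    have e5 : (1 - s) * (A - C) + s * (B - C) = 0 := by linear_combination e1 - e4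
    rcases lt_trichotomy (A - C) 0 with h | h | h
    · rw [sign_neg h, eq_comm, sign_eq_neg_one_iff] at e2
      rcases hs0.eq_or_lt with rfl | hs0
      · linarith
      · nlinarith [mul_pos hs0 (neg_pos.2 e2), mul_nonneg (sub_nonneg.2 hs1) (neg_pos.2 h).le]
    · rw [h, sign_zero, eq_comm, sign_eq_zero_iff] at e2
      linarith
    · rw [sign_pos h, eq_comm, sign_eq_one_iff] at e2
      rcases hs0.eq_or_lt with rfl | hs0
      · linarith
      · nlinarith [mul_pos hs0 e2, mul_nonneg (sub_nonneg.2 hs1) h.le]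
  let S : Set (I → SignType) := sg b₀ '' X
  have hS : ∀ x, x ∈ X ↔ sg b₀ x ∈ S :=
    fun x => ⟨fun hx => ⟨x, hx, rfl⟩, fun ⟨y, hy, hyx⟩ => (hsep y x hyx).1 hy⟩
  -- The sign patterns `S` stay fixed while the offsets become variables: the offsets for which
  -- these patterns describe `X` form a definable set that contains `b₀`, hence a rational point.
  have hdefZ : (∅ : Set ℝ).Definable L
      {g : I ⊕ Fin n → ℝ | g ∘ Sum.inr ∈ X ↔ sg (g ∘ Sum.inl) (g ∘ Sum.inr) ∈ S} := by
    have d1 : (∅ : Set ℝ).Definable L {g : I ⊕ Fin n → ℝ | g ∘ Sum.inr ∈ X} :=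
      hdef.preimage_comp Sum.inr
    have d2 : (∅ : Set ℝ).Definable L
        {g : I ⊕ Fin n → ℝ | sg (g ∘ Sum.inl) (g ∘ Sum.inr) ∈ S} :=
      (definable_signs_mem (f := fun i (g : I ⊕ Fin n → ℝ) =>
        ∑ j, (a i j : ℝ) * g (Sum.inr j) - g (Sum.inl i))
        (fun i => (RatAff.sum _ fun j => (RatAff.var (Sum.inr j)).smul (a i j)).sub
          (RatAff.var (Sum.inl i))) S).map_expansion ι
    convert! (d1.inter d2).union (d1.compl.inter d2.compl) using 1
    ext g
    simp only [mem_ofPred_eq, mem_union, mem_inter_iff, mem_compl_iff]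
    tauto
  let k := Fintype.equivFin I
  obtain ⟨q, hq⟩ := hrat _ _ ((definable_forall hdefZ).preimage_comp k)
    ⟨b₀ ∘ k.symm, by
      simp only [mem_preimage, mem_ofPred_eq, Function.comp_assoc, Equiv.symm_comp_self,
        Function.comp_id]
      exact hS⟩
  have hq' : ∀ x, x ∈ X ↔ sg (fun i => (q (k i) : ℝ)) x ∈ S := hq
  have hdl := definable_signs_mem (f := fun i (x : Fin n → ℝ) =>
        ∑ j, (a i j : ℝ) * x j - (q (k i) : ℝ))
        (fun i => (RatAff.sum _ fun j => (RatAff.var j).smul (a i j)).sub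
          (RatAff.const (q (k i)))) S
  convert! hdl using 1
  ext x
  exact hq' x

end Main

open Filter Topology Set Metric

/-! ### Sets determined by signs of affine forms -/

section SignDetermined

variable {E F : Type*} [AddCommGroup E] [Module ℝ E] [AddCommGroup F] [Module ℝ F]

/-- The sign of the affine form `p.1 + p.2` at `x`. -/
noncomputable def affSign (p : (E →ₗ[ℝ] ℝ) × ℝ) (x : E) : SignType := SignType.sign (p.1 x + p.2)

/-- Membership in `X` depends only on the signs of finitely many affine forms. -/
def SignDetermined (X : Set E) : Prop :=
  ∃ S : Set ((E →ₗ[ℝ] ℝ) × ℝ), S.Finite ∧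
    ∀ x y, (∀ p ∈ S, affSign p x = affSign p y) → (x ∈ X ↔ y ∈ X)

theorem signDetermined_lt (p q : (E →ₗ[ℝ] ℝ) × ℝ) :
    SignDetermined {x | p.1 x + p.2 < q.1 x + q.2} := by
  refine ⟨{q - p}, finite_singleton _, fun x y h => ?_⟩
  have h1 := h _ rfl
  have key : ∀ x, x ∈ {x | p.1 x + p.2 < q.1 x + q.2} ↔ affSign (q - p) x = 1 := by
    intro x
    rw [affSign, sign_eq_one_iff, mem_ofPred_eq, Prod.fst_sub, Prod.snd_sub, LinearMap.sub_apply]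
    constructor <;> intro h <;> linarith
  rw [key, key, h1]

theorem signDetermined_eq (p q : (E →ₗ[ℝ] ℝ) × ℝ) :
    SignDetermined {x | p.1 x + p.2 = q.1 x + q.2} := by
  refine ⟨{q - p}, finite_singleton _, fun x y h => ?_⟩
  have h1 := h _ rfl
  have key : ∀ x, x ∈ {x | p.1 x + p.2 = q.1 x + q.2} ↔ affSign (q - p) x = 0 := by
    intro x
    rw [affSign, sign_eq_zero_iff, mem_ofPred_eq, Prod.fst_sub, Prod.snd_sub, LinearMap.sub_apply]
    constructor <;> intro h <;> linarith
  rw [key, key, h1]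

theorem SignDetermined.imp {X Y : Set E} (hX : SignDetermined X) (hY : SignDetermined Y) :
    SignDetermined {x | x ∈ X → x ∈ Y} := by
  obtain ⟨S, hS, h⟩ := hX
  obtain ⟨T, hT, h'⟩ := hY
  refine ⟨S ∪ T, hS.union hT, fun x y hxy => ?_⟩
  rw [mem_ofPred_eq, mem_ofPred_eq, h x y fun p hp => hxy p (Or.inl hp),
    h' x y fun p hp => hxy p (Or.inr hp)]

theorem SignDetermined.preimage {X : Set E} (hX : SignDetermined X) (g : F →ₗ[ℝ] E) :
    SignDetermined (g ⁻¹' X) := by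
  obtain ⟨S, hS, h⟩ := hX
  refine ⟨(fun p => (p.1 ∘ₗ g, p.2)) '' S, hS.image _, fun x y hxy => ?_⟩
  exact h _ _ fun p hp => hxy _ (mem_image_of_mem _ hp)

/-- The position of a point relative to finitely many reals can be copied to any other reals in
the same order. -/
theorem exists_same_position {ι : Type*} {S : Set ι} (hS : S.Finite) (a b : ι → ℝ)
    (hab : ∀ i ∈ S, ∀ j ∈ S, SignType.sign (a i - a j) = SignType.sign (b i - b j)) (t : ℝ) :
    ∃ u, ∀ i ∈ S, SignType.sign (t - a i) = SignType.sign (u - b i) := by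
  classical
  by_cases hex : ∃ i ∈ S, a i = t
  · obtain ⟨i, hi, rfl⟩ := hex
    exact ⟨b i, fun j hj => hab i hi j hj⟩
  · push Not at hex
    obtain ⟨u, hu1, hu2⟩ := Order.exists_between_finsets
      ((hS.toFinset.filter fun i => a i < t).image b)
      ((hS.toFinset.filter fun i => t < a i).image b) (by
        simp only [Finset.mem_image, Finset.mem_filter, Finite.mem_toFinset]
        rintro _ ⟨i, ⟨hi, hit⟩, rfl⟩ _ ⟨j, ⟨hj, hjt⟩, rfl⟩
        have h := hab i hi j hj
        rw [sign_neg (by linarith), eq_comm, sign_eq_neg_one_iff] at h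
        linarith)
    refine ⟨u, fun i hi => ?_⟩
    rcases lt_or_gt_of_ne (hex i hi) with h | h
    · have := hu1 (b i) (Finset.mem_image_of_mem _ (by simp [hi, h]))
      rw [sign_pos (by linarith), sign_pos (by linarith)]
    · have := hu2 (b i) (Finset.mem_image_of_mem _ (by simp [hi, h]))
      rw [sign_neg (by linarith), sign_neg (by linarith)]

/-- Elimination of a quantifier. -/
theorem SignDetermined.forall {X : Set (E × ℝ)} (hX : SignDetermined X) :
    SignDetermined {x : E | ∀ t, (x, t) ∈ X} := by
  obtain ⟨S, hS, h⟩ := hX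
  let β : ((E × ℝ →ₗ[ℝ] ℝ) × ℝ) → ℝ := fun p => p.1 (0, 1)
  let base : ((E × ℝ →ₗ[ℝ] ℝ) × ℝ) → (E →ₗ[ℝ] ℝ) × ℝ :=
    fun p => (p.1 ∘ₗ LinearMap.inl ℝ E ℝ, p.2)
  -- The root in `t` as an affine form in `x`. If `β p = 0`, then `0⁻¹ = 0` makes it the zero form,
  -- which only adds a harmless extra root.
  let τ : ((E × ℝ →ₗ[ℝ] ℝ) × ℝ) → (E →ₗ[ℝ] ℝ) × ℝ := fun p => (-(β p)⁻¹) • base p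
  have hval : ∀ (p : (E × ℝ →ₗ[ℝ] ℝ) × ℝ) x t,
      p.1 (x, t) + p.2 = (base p).1 x + (base p).2 + β p * t := by
    intro p x t
    have : ((x, t) : E × ℝ) = (x, 0) + t • (0, 1) := by simp
    rw [this, map_add, map_smul]
    simp [base, β]; ring
  have hval' : ∀ (p : (E × ℝ →ₗ[ℝ] ℝ) × ℝ) x t, β p ≠ 0 →
      p.1 (x, t) + p.2 = β p * (t - ((τ p).1 x + (τ p).2)) := by
    intro p x t hp
    rw [hval]
    simp [τ]
    field_simp
    ring
  -- The differences of roots fix the order of all roots, and thereby which positions of `t`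
  -- relative to them occur; `base` covers the forms independent of `t`.
  refine ⟨base '' S ∪ (fun pq => τ pq.1 - τ pq.2) '' (S ×ˢ S),
    (hS.image _).union ((hS.prod hS).image _), fun x y hxy => ?_⟩
  have key : ∀ x y, (∀ p ∈ base '' S ∪ (fun pq => τ pq.1 - τ pq.2) '' (S ×ˢ S),
      affSign p x = affSign p y) → (∀ t, (y, t) ∈ X) → ∀ t, (x, t) ∈ X := by
    intro x y hxy hy t
    obtain ⟨u, hu⟩ := exists_same_position hS (fun p => (τ p).1 x + (τ p).2)
      (fun p => (τ p).1 y + (τ p).2) (fun p hp q hq => by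
        have h1 := hxy _ (Or.inr (mem_image_of_mem _ (mk_mem_prod hp hq)))
        simp only [affSign, Prod.fst_sub, Prod.snd_sub, LinearMap.sub_apply] at h1
        convert! h1 using 2 <;> ring) t
    refine (h (x, t) (y, u) fun p hp => ?_).2 (hy u)
    by_cases h0 : β p = 0
    · have h1 := hxy _ (Or.inl (mem_image_of_mem _ hp))
      rw [affSign, affSign, hval, hval, h0, zero_mul, zero_mul, add_zero, add_zero]
      exact h1
    · rw [affSign, affSign, hval' p _ _ h0, hval' p _ _ h0, sign_mul, sign_mul, hu p hp]
  exact ⟨key y x fun p hp => (hxy p hp).symm, key x y hxy⟩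

end SignDetermined

/-! ### Quantifier elimination for the reals with addition, order and one -/

section QuantifierElimination

variable {α : Type}

theorem exists_affine_term {k : ℕ} (t : lang.Term (α ⊕ Fin k)) :
    ∃ p : (((α → ℝ) × (Fin k → ℝ)) →ₗ[ℝ] ℝ) × ℝ, ∀ x,
      t.realize (Sum.elim x.1 x.2) = p.1 x + p.2 := by
  induction t with
  | var a =>
    rcases a with a | i
    · exact ⟨(LinearMap.proj a ∘ₗ LinearMap.fst ℝ _ _, 0), fun x => by simp⟩
    · exact ⟨(LinearMap.proj i ∘ₗ LinearMap.snd ℝ _ _, 0), fun x => by simp⟩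
  | func f ts ih =>
    cases f with
    | one => exact ⟨(0, 1), fun x => by rw [LinearMap.zero_apply, zero_add]; rfl⟩
    | add =>
      obtain ⟨p, hp⟩ := ih 0
      obtain ⟨q, hq⟩ := ih 1
      refine ⟨p + q, fun x => ?_⟩
      have : (Language.Term.func (L := lang) Func.add ts).realize (Sum.elim x.1 x.2) =
        (ts 0).realize (Sum.elim x.1 x.2) + (ts 1).realize (Sum.elim x.1 x.2) := rfl
      rw [this, hp, hq, Prod.fst_add, Prod.snd_add, LinearMap.add_apply]
      ring

theorem signDetermined_realize {k : ℕ} (φ : lang.BoundedFormula α k) :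
    SignDetermined {x : (α → ℝ) × (Fin k → ℝ) | φ.Realize x.1 x.2} := by
  induction φ with
  | falsum => exact ⟨∅, finite_empty, fun x y _ => Iff.rfl⟩
  | equal t u =>
    obtain ⟨p, hp⟩ := exists_affine_term t
    obtain ⟨q, hq⟩ := exists_affine_term u
    convert! signDetermined_eq p q using 1
    ext x
    rw [mem_ofPred_eq, mem_ofPred_eq, ← hp, ← hq]
    rfl
  | rel R ts =>
    cases R with
    | lt =>
      obtain ⟨p, hp⟩ := exists_affine_term (ts 0)
      obtain ⟨q, hq⟩ := exists_affine_term (ts 1)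
      convert! signDetermined_lt p q using 1
      ext x
      rw [mem_ofPred_eq, mem_ofPred_eq, ← hp, ← hq]
      rfl
  | imp φ ψ h1 h2 => exact h1.imp h2
  | @all k φ ih =>
    let g : (((α → ℝ) × (Fin k → ℝ)) × ℝ) →ₗ[ℝ] (α → ℝ) × (Fin (k + 1) → ℝ) :=
      { toFun := fun x => (x.1.1, Fin.snoc x.1.2 x.2)
        map_add' := by
          intro x y
          refine Prod.ext rfl ?_
          ext i
          refine Fin.lastCases ?_ (fun i => ?_) i <;> simp
        map_smul' := by
          intro c x
          refine Prod.ext rfl ?_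
          ext i
          refine Fin.lastCases ?_ (fun i => ?_) i <;> simp }
    exact (ih.preimage g).forall

theorem IsDefinable.signDetermined {n : ℕ} {X : Set (Fin n → ℝ)} (hX : IsDefinable lang X) :
    SignDetermined X := by
  obtain ⟨φ, rfl⟩ := empty_definable_iff.1 hX
  convert! (signDetermined_realize φ).preimage (LinearMap.prod LinearMap.id 0) using 1
  ext x
  simp only [mem_ofPred_eq, mem_preimage, Language.Formula.Realize]
  congr! 1

end QuantifierElimination

/-! ### Necessity of the criterion -/

section Necessity

variable {n : ℕ} {X : Set (Fin n → ℝ)}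

theorem exists_ball_affSign {S : Set (((Fin n → ℝ) →ₗ[ℝ] ℝ) × ℝ)} (hS : S.Finite)
    (x : Fin n → ℝ) : ∃ δ > 0, ∀ p ∈ S, p.1 x + p.2 ≠ 0 → ∀ y ∈ ball x δ,
      affSign p y = affSign p x := by
  have h : ∀ᶠ y in 𝓝 x, ∀ p ∈ S, p.1 x + p.2 ≠ 0 → affSign p y = affSign p x := by
    refine (eventually_all_finite hS).2 fun p _ => ?_
    have hc : Continuous fun y => p.1 y + p.2 :=
      p.1.continuous_of_finiteDimensional.add continuous_const
    by_cases h0 : p.1 x + p.2 = 0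
    · simp [h0]
    rcases lt_or_gt_of_ne h0 with h | h
    · filter_upwards [hc.continuousAt.preimage_mem_nhds (Iio_mem_nhds h)] with y hy _
      rw [affSign, affSign, sign_neg h, sign_neg hy]
    · filter_upwards [hc.continuousAt.preimage_mem_nhds (Ioi_mem_nhds h)] with y hy _
      rw [affSign, affSign, sign_pos h, sign_pos hy]
  obtain ⟨δ, hδ, h⟩ := Metric.eventually_nhds_iff_ball.1 h
  exact ⟨δ, hδ, fun p hp h0 y hy => h y hy p hp h0⟩

/-- Forms that vanish at `x` are multiplied by the ratio under a contraction about `x`; the others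
have constant sign near `x`. -/
theorem SignDetermined.scalingCriterion (hX : SignDetermined X) : ScalingCriterion X := by
  obtain ⟨S, hS, h⟩ := hX
  intro x
  obtain ⟨δ, hδ, hball⟩ := exists_ball_affSign hS x
  have key : ∀ y ∈ ball x δ, ∀ z, ∀ c : ℝ, 0 < c → c ≤ 1 → z = x + c • (y - x) →
      (y ∈ X ↔ z ∈ X) := by
    intro y hy z c hc hc1 hz
    refine h y z fun p hp => ?_
    by_cases h0 : p.1 x + p.2 = 0
    · have : p.1 z + p.2 = c * (p.1 y + p.2) := by
        rw [hz, map_add, map_smul, map_sub, smul_eq_mul]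
        linear_combination (1 - c) * h0
      rw [affSign, affSign, this, sign_mul, sign_pos hc, one_mul]
    · rw [hball p hp h0 y hy, hball p hp h0 z]
      rw [mem_ball, dist_eq_norm] at *
      rw [hz, add_sub_cancel_left, norm_smul, Real.norm_of_nonneg hc.le]
      exact (mul_le_of_le_one_left (norm_nonneg _) hc1).trans_lt hy
  refine ⟨fun _ => δ, fun _ => hδ, fun y hy z => ⟨fun hz => ?_, fun hz => ?_⟩⟩
  · refine key y ((near_const_iff hδ).1 hy) z (1 / 2) (by norm_num) (by norm_num) ?_
    ext j
    have := congrFun hz j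
    simp at this ⊢
    linarith
  · refine key y ((near_const_iff hδ).1 hy) z (1 / 3) (by norm_num) (by norm_num) ?_
    ext j
    have := congrFun hz j
    simp at this ⊢
    linarith

/-- A direction in the coordinate subspace that kills all forms vanishing at `x` gives local periods
of every small length. The exceptional points `B` with no such nonzero direction are determined by
the set of forms that vanish there, so they are finitely many. -/
theorem SignDetermined.sectionCriterion (hX : SignDetermined X) : SectionCriterion X := by
  obtain ⟨S, hS, h⟩ := hX
  intro e
  let I : (Fin n → ℝ) → Set (((Fin n → ℝ) →ₗ[ℝ] ℝ) × ℝ) := fun x => {p ∈ S | p.1 x + p.2 = 0}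
  let B : Set (Fin n → ℝ) := {x | Disj e x ∧ ∀ v, Disj e v → (∀ p ∈ I x, p.1 v = 0) → v = 0}
  have hB : B.Finite := by
    refine Finite.of_finite_image (f := I) (hS.finite_subsets.subset ?_) ?_
    · rintro _ ⟨x, -, rfl⟩
      exact fun p hp => hp.1
    · rintro x ⟨hx, -⟩ y ⟨hy, hy'⟩ hxy
      rw [← sub_eq_zero]
      refine hy' _ (fun j => ?_) fun p hp => ?_
      · rcases hx j with h1 | h1
        · exact Or.inl h1
        rcases hy j with h2 | h2
        · exact Or.inl h2
        · right; simp [h1, h2]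
      · have h1 := hp.2
        rw [← hxy] at hp
        have h2 := hp.2
        rw [map_sub]; linarith
  obtain ⟨R, hR⟩ := hB.isBounded.subset_ball_lt 0 0
  refine ⟨fun _ => R, fun x hx => ?_⟩
  by_cases hxB : x ∈ B
  · exact Or.inl ((near_const_iff hR.1).2 (hR.2 hxB))
  right
  obtain ⟨w, hw1, hw2, hw3⟩ : ∃ w, Disj e w ∧ (∀ p ∈ I x, p.1 w = 0) ∧ w ≠ 0 := by
    by_contra hcon
    push Not at hcon
    exact hxB ⟨hx, hcon⟩
  obtain ⟨δ, hδ, hball⟩ := exists_ball_affSign hS x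
  -- Half of `δ` for the point and half for the shift, so that `y + v` stays where the nonvanishing
  -- forms keep their signs.
  refine ⟨fun _ => δ / 2, fun _ => by positivity, fun r hr hrδ => ?_⟩
  obtain ⟨η, hη, hηr⟩ := exists_pos_lt r hr
  have hwpos : 0 < ‖w‖ := norm_pos_iff.2 hw3
  have htpos : 0 < η / (‖w‖ + 1) := by positivity
  have hnorm : ‖(η / (‖w‖ + 1)) • w‖ < η := by
    rw [norm_smul, Real.norm_of_nonneg htpos.le, div_mul_eq_mul_div, div_lt_iff₀ (by positivity)]
    nlinarith
  have hnear : Near 0 ((η / (‖w‖ + 1)) • w) r :=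
    ((near_const_iff hη).2 (by simpa using hnorm)).mono fun j => (hηr j).le
  have hnear' : (η / (‖w‖ + 1)) • w ∈ ball 0 (δ / 2) :=
    (near_const_iff (by positivity)).1 (hnear.mono fun j => (hrδ j).le)
  refine ⟨(η / (‖w‖ + 1)) • w, smul_ne_zero htpos.ne' hw3, fun j => ?_, hnear, fun y _ hy => ?_⟩
  · rcases hw1 j with h1 | h1
    · exact Or.inl h1
    · right; simp [h1]
  · have hy' : y ∈ ball x (δ / 2) :=
      (near_const_iff (by positivity)).1 (hy.mono fun j => (hrδ j).le)
    refine h _ _ fun p hp => ?_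
    by_cases h0 : p.1 x + p.2 = 0
    · rw [affSign, affSign, p.1.map_add, p.1.map_smul, hw2 p ⟨hp, h0⟩, smul_zero, add_zero]
    · rw [hball p hp h0 y (ball_subset_ball (by linarith) hy'), hball p hp h0 (y + _)]
      rw [mem_ball, dist_eq_norm] at *
      rw [sub_zero] at hnear'
      rw [add_sub_right_comm]
      linarith [norm_add_le (y - x) ((η / (‖w‖ + 1)) • w)]

end Necessity

/-! ### Renaming variables in Gödel numbers -/

section Renaming

/-- With a positive tag, the components of a code are strictly smaller than the code, so
course-of-values recursion reaches them. -/
theorem lt_pair_succ (h x : ℕ) : x < Nat.pair (h + 1) x := by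
  unfold Nat.pair
  split_ifs <;> nlinarith

/-- Renaming of the code of a variable, with parameters `(n, b, m)`: the free variable `i < n`
becomes the bound variable `b + i`, and the bound variable `j` becomes `m + j`. -/
def renVar (a : ℕ × ℕ × ℕ) (v : ℕ) : ℕ :=
  if v % 2 = 0 then (if v / 2 < a.1 then 2 * (a.2.1 + v / 2) + 1 else v)
  else 2 * (a.2.2 + v / 2) + 1

/-- One step of the recursion that renames variables in codes of terms, of lists of terms and of
formulas. -/
def renStep (a : ℕ × ℕ × ℕ) (N : ℕ) (f : ℕ → ℕ × ℕ × ℕ) : ℕ × ℕ × ℕ :=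
  (if N.unpair.1 = 0 then Nat.pair 0 (renVar a N.unpair.2)
    else if N.unpair.1 = 1 then
      Nat.pair 1 (Nat.pair N.unpair.2.unpair.1 (f N.unpair.2.unpair.2).2.1)
    else N,
   if N = 0 then 0 else Nat.pair (f (N - 1).unpair.1).1 (f (N - 1).unpair.2).2.1 + 1,
   if N.unpair.1 = 1 then
      Nat.pair 1 (Nat.pair (f N.unpair.2.unpair.1).1 (f N.unpair.2.unpair.2).1)
    else if N.unpair.1 = 2 then
      Nat.pair 2 (Nat.pair N.unpair.2.unpair.1 (f N.unpair.2.unpair.2).2.1)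
    else if N.unpair.1 = 3 then
      Nat.pair 3 (Nat.pair (f N.unpair.2.unpair.1).2.2 (f N.unpair.2.unpair.2).2.2)
    else if N.unpair.1 = 4 then Nat.pair 4 (f N.unpair.2).2.2
    else N)

/-- Renaming of variables in codes: of terms, of lists of terms and of formulas. -/
def ren (a : ℕ × ℕ × ℕ) (N : ℕ) : ℕ × ℕ × ℕ :=
  renStep a N fun i => if i < N then ren a i else (0, 0, 0)
termination_by N
decreasing_by assumption

/-- Renaming of variables in the code of a term. -/
def renT (a : ℕ × ℕ × ℕ) (N : ℕ) : ℕ := (ren a N).1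

/-- Renaming of variables in the code of a list of terms. -/
def renL (a : ℕ × ℕ × ℕ) (N : ℕ) : ℕ := (ren a N).2.1

/-- Renaming of variables in the code of a formula. -/
def renF (a : ℕ × ℕ × ℕ) (N : ℕ) : ℕ := (ren a N).2.2

variable (a : ℕ × ℕ × ℕ)

theorem renT_var (v : ℕ) : renT a (Nat.pair 0 v) = Nat.pair 0 (renVar a v) := by
  rw [renT, ren]; simp [renStep]

theorem renT_func (f l : ℕ) :
    renT a (Nat.pair 1 (Nat.pair f l)) = Nat.pair 1 (Nat.pair f (renL a l)) := by
  have h : l < Nat.pair 1 (Nat.pair f l) := (Nat.right_le_pair f l).trans_lt (lt_pair_succ 0 _)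
  rw [renT, ren]; simp [renStep, h, renL]

theorem renL_zero : renL a 0 = 0 := by
  rw [renL, ren]; simp [renStep]

theorem renL_succ (t l : ℕ) :
    renL a (Nat.pair t l + 1) = Nat.pair (renT a t) (renL a l) + 1 := by
  have h1 : t < Nat.pair t l + 1 := Nat.lt_succ_of_le (Nat.left_le_pair t l)
  have h2 : l < Nat.pair t l + 1 := Nat.lt_succ_of_le (Nat.right_le_pair t l)
  rw [renL, ren]; simp [renStep, h1, h2, renL, renT]

theorem renF_zero (x : ℕ) : renF a (Nat.pair 0 x) = Nat.pair 0 x := by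
  rw [renF, ren]; simp [renStep]

theorem renF_equal (t u : ℕ) : renF a (Nat.pair 1 (Nat.pair t u)) =
    Nat.pair 1 (Nat.pair (renT a t) (renT a u)) := by
  have h1 := (Nat.left_le_pair t u).trans_lt (lt_pair_succ 0 _)
  have h2 := (Nat.right_le_pair t u).trans_lt (lt_pair_succ 0 _)
  rw [zero_add] at h1 h2
  rw [renF, ren]; simp [renStep, h1, h2, renT]

theorem renF_rel (R l : ℕ) : renF a (Nat.pair 2 (Nat.pair R l)) =
    Nat.pair 2 (Nat.pair R (renL a l)) := by
  have h2 := (Nat.right_le_pair R l).trans_lt (lt_pair_succ 1 _)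
  rw [show 1 + 1 = 2 from rfl] at h2
  rw [renF, ren]; simp [renStep, h2, renL]

theorem renF_imp (t u : ℕ) : renF a (Nat.pair 3 (Nat.pair t u)) =
    Nat.pair 3 (Nat.pair (renF a t) (renF a u)) := by
  have h1 := (Nat.left_le_pair t u).trans_lt (lt_pair_succ 2 _)
  have h2 := (Nat.right_le_pair t u).trans_lt (lt_pair_succ 2 _)
  rw [show 2 + 1 = 3 from rfl] at h1 h2
  rw [renF, ren]; simp [renStep, h1, h2, renF]

theorem renF_all (t : ℕ) : renF a (Nat.pair 4 t) = Nat.pair 4 (renF a t) := by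
  have h1 := lt_pair_succ 3 t
  rw [show 3 + 1 = 4 from rfl] at h1
  rw [renF, ren]; simp [renStep, h1, renF]

/-- Renaming preserves the leading tag, so the shape of a code can be recovered from its renamed
version. -/
theorem unpair_renT_fst (c : ℕ) : (renT a c).unpair.1 = c.unpair.1 := by
  rw [renT, ren]
  simp only [renStep]
  split_ifs with h1 h2 <;> simp [*]

theorem unpair_renF_fst (c : ℕ) : (renF a c).unpair.1 = c.unpair.1 := by
  rw [renF, ren]
  simp only [renStep]
  split_ifs with h1 h2 h3 h4 <;> simp [*]

theorem renL_encode (l : List ℕ) : renL a (Encodable.encode l) =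
    Encodable.encode (l.map (renT a)) := by
  induction l with
  | nil => simp [renL_zero]
  | cons t l ih =>
    rw [List.map_cons, Encodable.encode_list_cons, Encodable.encode_list_cons, ← ih]
    simp [renL_succ]

theorem exists_pair (c : ℕ) : ∃ h x, c = Nat.pair h x := ⟨_, _, (Nat.pair_unpair c).symm⟩

theorem exists_pair_of_renT_eq {c h x : ℕ} (hc : renT a c = Nat.pair h x) :
    ∃ y, c = Nat.pair h y := by
  have h1 := unpair_renT_fst a c
  rw [hc, Nat.unpair_pair] at h1
  exact ⟨c.unpair.2, by rw [show h = c.unpair.1 from h1, Nat.pair_unpair]⟩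

theorem exists_pair_of_renF_eq {c h x : ℕ} (hc : renF a c = Nat.pair h x) :
    ∃ y, c = Nat.pair h y := by
  have h1 := unpair_renF_fst a c
  rw [hc, Nat.unpair_pair] at h1
  exact ⟨c.unpair.2, by rw [show h = c.unpair.1 from h1, Nat.pair_unpair]⟩

theorem primrec_renVar : Primrec₂ renVar := by
  have hv : Primrec fun p : (ℕ × ℕ × ℕ) × ℕ => p.2 := Primrec.snd
  have hd : Primrec fun p : (ℕ × ℕ × ℕ) × ℕ => p.2 / 2 := Primrec.nat_div.comp hv (Primrec.const 2)
  have hm : Primrec fun p : (ℕ × ℕ × ℕ) × ℕ => p.2 % 2 := Primrec.nat_mod.comp hv (Primrec.const 2)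
  have hn : Primrec fun p : (ℕ × ℕ × ℕ) × ℕ => p.1.1 := Primrec.fst.comp Primrec.fst
  have hb : Primrec fun p : (ℕ × ℕ × ℕ) × ℕ => p.1.2.1 :=
    Primrec.fst.comp (Primrec.snd.comp Primrec.fst)
  have hk : Primrec fun p : (ℕ × ℕ × ℕ) × ℕ => p.1.2.2 :=
    Primrec.snd.comp (Primrec.snd.comp Primrec.fst)
  have odd : ∀ {f : (ℕ × ℕ × ℕ) × ℕ → ℕ}, Primrec f →
      Primrec fun p => 2 * (f p + p.2 / 2) + 1 := fun hf =>
    Primrec.succ.comp (Primrec.nat_mul.comp (Primrec.const 2) (Primrec.nat_add.comp hf hd))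
  exact Primrec.ite (Primrec.eq.comp hm (Primrec.const 0))
    (Primrec.ite (Primrec.nat_lt.comp hd hn) (odd hb) hv) (odd hk)

theorem primrec_ren : Primrec₂ ren := by
  -- A number does not show whether it codes a term, a list or a formula, so all three renamings are
  -- computed together from the list of earlier values. The lookup default `(0, 0, 0)` agrees with
  -- the value used in `ren` beyond `N`.
  let g : ℕ × ℕ × ℕ → List (ℕ × ℕ × ℕ) → Option (ℕ × ℕ × ℕ) := fun a l =>
    some (renStep a l.length fun i => l.getD i (0, 0, 0))
  refine Primrec.nat_strong_rec ren (g := g) ?_ ?_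
  · let D := (ℕ × ℕ × ℕ) × List (ℕ × ℕ × ℕ)
    have hN : Primrec fun p : D => p.2.length := Primrec.list_length.comp Primrec.snd
    have look : ∀ {i : D → ℕ}, Primrec i → Primrec fun p : D => p.2.getD (i p) (0, 0, 0) :=
      fun hi => (Primrec.list_getD _).comp Primrec.snd hi
    have un1 : ∀ {i : D → ℕ}, Primrec i → Primrec fun p : D => (i p).unpair.1 :=
      fun hi => Primrec.fst.comp (Primrec.unpair.comp hi)
    have un2 : ∀ {i : D → ℕ}, Primrec i → Primrec fun p : D => (i p).unpair.2 :=
      fun hi => Primrec.snd.comp (Primrec.unpair.comp hi)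
    have lookT : ∀ {i : D → ℕ}, Primrec i → Primrec fun p : D => (p.2.getD (i p) (0, 0, 0)).1 :=
      fun hi => Primrec.fst.comp (look hi)
    have lookL : ∀ {i : D → ℕ}, Primrec i → Primrec fun p : D => (p.2.getD (i p) (0, 0, 0)).2.1 :=
      fun hi => Primrec.fst.comp (Primrec.snd.comp (look hi))
    have lookF : ∀ {i : D → ℕ}, Primrec i → Primrec fun p : D => (p.2.getD (i p) (0, 0, 0)).2.2 :=
      fun hi => Primrec.snd.comp (Primrec.snd.comp (look hi))
    have pr : ∀ {i j : D → ℕ}, Primrec i → Primrec j → Primrec fun p : D => Nat.pair (i p) (j p) :=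
      fun hi hj => Primrec₂.natPair.comp hi hj
    have hd : ∀ k : ℕ, PrimrecPred fun p : D => p.2.length.unpair.1 = k := fun k =>
      Primrec.eq.comp (un1 hN) (Primrec.const k)
    have h1 := un1 (un2 hN)
    have h2 := un2 (un2 hN)
    have hpred : Primrec fun p : D => p.2.length - 1 := Primrec.pred.comp hN
    have hT : Primrec fun p : D => (renStep p.1 p.2.length fun i => p.2.getD i (0, 0, 0)).1 :=
      Primrec.ite (hd 0) (pr (Primrec.const 0) (primrec_renVar.comp Primrec.fst (un2 hN)))
        (Primrec.ite (hd 1) (pr (Primrec.const 1) (pr h1 (lookL h2))) hN)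
    have hL : Primrec fun p : D => (renStep p.1 p.2.length fun i => p.2.getD i (0, 0, 0)).2.1 :=
      Primrec.ite (Primrec.eq.comp hN (Primrec.const 0)) (Primrec.const 0)
        (Primrec.succ.comp (pr (lookT (un1 hpred)) (lookL (un2 hpred))))
    have hF : Primrec fun p : D => (renStep p.1 p.2.length fun i => p.2.getD i (0, 0, 0)).2.2 :=
      Primrec.ite (hd 1) (pr (Primrec.const 1) (pr (lookT h1) (lookT h2)))
        (Primrec.ite (hd 2) (pr (Primrec.const 2) (pr h1 (lookL h2)))
          (Primrec.ite (hd 3) (pr (Primrec.const 3) (pr (lookF h1) (lookF h2)))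
            (Primrec.ite (hd 4) (pr (Primrec.const 4) (lookF (un2 hN))) hN)))
    exact Primrec.option_some.comp (Primrec.pair hT (Primrec.pair hL hF))
  · intro a N
    simp only [g, List.length_map, List.length_range, Option.some.injEq]
    rw [ren]
    congr 1
    funext i
    by_cases hi : i < N <;> simp [hi, List.getD_eq_getElem?_getD]

theorem primrec_renF : Primrec₂ renF := Primrec.snd.comp (Primrec.snd.comp primrec_ren)

end Renaming

/-! ### Syntax recovered from codes -/

section Codes

open Language

variable {L : Language} [∀ n, Encodable (L.Functions n)]

theorem termCode_injective {α : Type} [Encodable α] :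
    Function.Injective (termCode : L.Term α → ℕ) := by
  intro t
  induction t with
  | var a =>
    rintro (b | ⟨f, ts⟩) h
    · simpa [termCode] using h
    · simp [termCode] at h
  | @func l f ts ih =>
    rintro (b | @⟨l', f', ts'⟩) h
    · simp [termCode] at h
    · simp only [termCode, Nat.pair_eq_pair, Encodable.encode_inj, true_and] at h
      obtain ⟨h1, h2⟩ := h
      obtain rfl : l = l' := by simpa using congrArg List.length h2
      obtain rfl := Encodable.encode_injective h1
      congr 1
      funext i
      exact ih i (congrFun (List.ofFn_injective h2) i)

variable {n b m : ℕ}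

/-- Free variables have even codes and bound ones odd codes. A free variable of index at least `n`
keeps its even code, so it cannot turn into a legitimate bound variable; this excludes illegitimate
input. -/
theorem exists_term_of_renT_eq {k : ℕ} (s : L.Term (Empty ⊕ Fin (m + k))) {c : ℕ}
    (hc : renT (n, b, m) c = termCode s) : ∃ t : L.Term (Fin n ⊕ Fin k), termCode t = c := by
  induction s generalizing c with
  | var i =>
    rcases i with i | i
    · exact i.elim
    · rw [termCode] at hc
      obtain ⟨v, rfl⟩ := exists_pair_of_renT_eq _ hc
      rw [renT_var, Nat.pair_eq_pair, Encodable.encode_inr] at hc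
      have hi : (Encodable.encode i : ℕ) = i := rfl
      rw [hi] at hc
      replace hc := hc.2
      have hlt := i.2
      rw [renVar] at hc
      split_ifs at hc with h1 h2
      · refine ⟨.var (Sum.inl ⟨v / 2, h2⟩), ?_⟩
        have e : Encodable.encode (⟨v / 2, h2⟩ : Fin n) = v / 2 := rfl
        rw [termCode, Encodable.encode_inl, e]
        congr 1; omega
      · omega
      · have hk : v / 2 < k := by simp only at hc; omega
        refine ⟨.var (Sum.inr ⟨v / 2, hk⟩), ?_⟩
        have e : Encodable.encode (⟨v / 2, hk⟩ : Fin k) = v / 2 := rfl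
        rw [termCode, Encodable.encode_inr, e]
        congr 1; omega
  | @func l f ts ih =>
    rw [termCode] at hc
    obtain ⟨x, rfl⟩ := exists_pair_of_renT_eq _ hc
    obtain ⟨e, lc, rfl⟩ := exists_pair x
    rw [renT_func, Nat.pair_eq_pair, Nat.pair_eq_pair] at hc
    obtain ⟨-, h1, h2⟩ := hc
    obtain ⟨us, hus⟩ := exists_args ih (lc := lc) h2
    exact ⟨.func f us, by rw [termCode, h1, hus]⟩
where
  exists_args {l k : ℕ} {ts : Fin l → L.Term (Empty ⊕ Fin (m + k))}
      (ih : ∀ i {c : ℕ}, renT (n, b, m) c = termCode (ts i) →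
        ∃ t : L.Term (Fin n ⊕ Fin k), termCode t = c) {lc : ℕ}
      (h : renL (n, b, m) lc = Encodable.encode (List.ofFn fun i => termCode (ts i))) :
      ∃ us : Fin l → L.Term (Fin n ⊕ Fin k),
        Encodable.encode (List.ofFn fun i => termCode (us i)) = lc := by
    obtain ⟨cs, rfl⟩ : ∃ cs : List ℕ, Encodable.encode cs = lc :=
      ⟨Denumerable.ofNat _ lc, Denumerable.encode_ofNat _⟩
    rw [renL_encode, Encodable.encode_inj] at h
    have hlen : cs.length = l := by simpa using congrArg List.length h
    subst hlen
    have : ∀ i : Fin cs.length, ∃ t : L.Term (Fin n ⊕ Fin k), termCode t = cs.get i := by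
      intro i
      apply ih i
      have h3 := congrArg (fun l => l[(i : ℕ)]?) h
      simpa using h3
    choose us hus using this
    refine ⟨us, ?_⟩
    rw [funext hus, List.ofFn_get]

theorem exists_renT_term [L.Structure ℝ] {k : ℕ} (hbm : b + n ≤ m) (t : L.Term (Fin n ⊕ Fin k)) :
    ∃ t' : L.Term (Empty ⊕ Fin (m + k)), termCode t' = renT (n, b, m) (termCode t) ∧
      ∀ v : ℕ → ℝ, t'.realize (Sum.elim default fun i : Fin (m + k) => v i) =
        t.realize (Sum.elim (fun i : Fin n => v (b + i)) fun j : Fin k => v (m + j)) := by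
  induction t with
  | var i =>
    rcases i with i | j
    · have hi := i.2
      refine ⟨.var (Sum.inr ⟨b + i, by omega⟩), ?_, fun v => by simp⟩
      rw [termCode, termCode, renT_var, Encodable.encode_inl, Encodable.encode_inr]
      have e1 : Encodable.encode (⟨b + i, by omega⟩ : Fin (m + k)) = b + i := rfl
      have e2 : Encodable.encode i = (i : ℕ) := rfl
      rw [e1, e2]
      simp [renVar]
    · have hj := j.2
      refine ⟨.var (Sum.inr ⟨m + j, by omega⟩), ?_, fun v => by simp⟩
      rw [termCode, termCode, renT_var, Encodable.encode_inr, Encodable.encode_inr]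
      have e1 : Encodable.encode (⟨m + j, by omega⟩ : Fin (m + k)) = m + j := rfl
      have e2 : Encodable.encode j = (j : ℕ) := rfl
      rw [e1, e2]
      have e3 : (2 * (j : ℕ) + 1) % 2 = 1 := by omega
      have e4 : (2 * (j : ℕ) + 1) / 2 = j := by omega
      simp [renVar, e3, e4]
  | func f ts ih =>
    choose us h1 h2 using ih
    refine ⟨.func f us, ?_, fun v => ?_⟩
    · rw [termCode, termCode, renT_func, renL_encode, List.map_ofFn]
      simp only [h1, Function.comp_def]
    · simp only [Term.realize, h2]

variable [∀ n, Encodable (L.Relations n)]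

theorem formulaCode_injective {α : Type} [Encodable α] {k : ℕ} :
    Function.Injective (formulaCode : L.BoundedFormula α k → ℕ) := by
  intro φ
  induction φ with
  | falsum => rintro (_ | _ | _ | _ | _) h <;> simp [formulaCode] at h ⊢
  | equal t u =>
    rintro (_ | ⟨t', u'⟩ | _ | _ | _) h <;> simp [formulaCode] at h
    rw [termCode_injective h.1, termCode_injective h.2]
  | @rel k l R ts =>
    rintro (_ | _ | @⟨_, l', R', ts'⟩ | _ | _) h <;>
      simp only [formulaCode, Nat.pair_eq_pair, OfNat.ofNat_ne_zero,
        OfNat.ofNat_ne_one, Nat.reduceEqDiff, false_and, true_and,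
        Encodable.encode_inj] at h
    obtain ⟨h1, h2⟩ := h
    obtain rfl : l = l' := by simpa using congrArg List.length h2
    obtain rfl := Encodable.encode_injective h1
    congr 1
    funext i
    exact termCode_injective (congrFun (List.ofFn_injective h2) i)
  | imp φ ψ h1 h2 =>
    rintro (_ | _ | _ | ⟨φ', ψ'⟩ | _) h <;> simp [formulaCode] at h
    rw [h1 h.1, h2 h.2]
  | all φ ih =>
    rintro (_ | _ | _ | _ | φ') h <;> simp [formulaCode] at h
    rw [ih h]

theorem exists_of_formulaCode_eq_imp {α : Type} [Encodable α] {k : ℕ} {φ : L.BoundedFormula α k}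
    {a b : ℕ} (h : formulaCode φ = Nat.pair 3 (Nat.pair a b)) :
    (∃ ψ : L.BoundedFormula α k, formulaCode ψ = a) ∧
      ∃ ψ : L.BoundedFormula α k, formulaCode ψ = b := by
  rcases φ with _ | _ | _ | ⟨φ, ψ⟩ | _ <;> simp [formulaCode] at h
  exact ⟨⟨φ, h.1⟩, ψ, h.2⟩

theorem exists_of_formulaCode_eq_all {α : Type} [Encodable α] {k : ℕ} {φ : L.BoundedFormula α k}
    {a : ℕ} (h : formulaCode φ = Nat.pair 4 a) :
    ∃ ψ : L.BoundedFormula α (k + 1), formulaCode ψ = a := by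
  rcases φ with _ | _ | _ | _ | φ <;> simp [formulaCode] at h
  exact ⟨φ, h⟩

/-- Renaming never makes a formula out of a number that was not the code of one. The depth is given
by an equation for `K` because quantifiers raise it during the induction. -/
theorem exists_formula_of_renF_eq {K : ℕ} (s : L.BoundedFormula Empty K) {k c : ℕ}
    (hK : K = m + k) (hc : renF (n, b, m) c = formulaCode s) :
    ∃ φ : L.BoundedFormula (Fin n) k, formulaCode φ = c := by
  induction s generalizing k c with
  | falsum =>
    rw [formulaCode] at hc
    obtain ⟨x, rfl⟩ := exists_pair_of_renF_eq _ hc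
    rw [renF_zero] at hc
    exact ⟨.falsum, by rw [formulaCode, hc]⟩
  | equal t u =>
    subst hK
    rw [formulaCode] at hc
    obtain ⟨x, rfl⟩ := exists_pair_of_renF_eq _ hc
    obtain ⟨c1, c2, rfl⟩ := exists_pair x
    rw [renF_equal, Nat.pair_eq_pair, Nat.pair_eq_pair] at hc
    obtain ⟨t', ht⟩ := exists_term_of_renT_eq t hc.2.1
    obtain ⟨u', hu⟩ := exists_term_of_renT_eq u hc.2.2
    exact ⟨.equal t' u', by rw [formulaCode, ht, hu]⟩
  | rel R ts =>
    subst hK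
    rw [formulaCode] at hc
    obtain ⟨x, rfl⟩ := exists_pair_of_renF_eq _ hc
    obtain ⟨c1, c2, rfl⟩ := exists_pair x
    rw [renF_rel, Nat.pair_eq_pair, Nat.pair_eq_pair] at hc
    obtain ⟨us, hus⟩ := exists_term_of_renT_eq.exists_args
      (fun i _ h => exists_term_of_renT_eq (ts i) h) hc.2.2
    exact ⟨.rel R us, by rw [formulaCode, hus, hc.2.1]⟩
  | imp φ ψ h1 h2 =>
    rw [formulaCode] at hc
    obtain ⟨x, rfl⟩ := exists_pair_of_renF_eq _ hc
    obtain ⟨c1, c2, rfl⟩ := exists_pair x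
    rw [renF_imp, Nat.pair_eq_pair, Nat.pair_eq_pair] at hc
    obtain ⟨φ', hφ⟩ := h1 hK hc.2.1
    obtain ⟨ψ', hψ⟩ := h2 hK hc.2.2
    exact ⟨.imp φ' ψ', by rw [formulaCode, hφ, hψ]⟩
  | all φ ih =>
    rw [formulaCode] at hc
    obtain ⟨x, rfl⟩ := exists_pair_of_renF_eq _ hc
    rw [renF_all, Nat.pair_eq_pair] at hc
    obtain ⟨φ', hφ⟩ := ih (k := k + 1) (by omega) hc.2
    exact ⟨.all φ', by rw [formulaCode, hφ]⟩

/-- Infinite valuations `ℕ → ℝ` replace tuples, so that changes of depth need no casts between `Fin`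
types. -/
theorem snoc_eq_update {k : ℕ} (v : ℕ → ℝ) (a : ℝ) :
    (Fin.snoc (fun i : Fin k => v i) a : Fin (k + 1) → ℝ) =
      fun i : Fin (k + 1) => Function.update v k a i := by
  ext i
  refine Fin.lastCases ?_ (fun i => ?_) i
  · simp
  · simp [Function.update_of_ne i.2.ne]

variable [L.Structure ℝ]

/-- The inequality `b + n ≤ m` keeps the block that receives the free variables below all the
quantifiers of `φ`, whose variables are shifted to start at `m`. -/
theorem exists_renF_formula {k : ℕ} (hbm : b + n ≤ m) (φ : L.BoundedFormula (Fin n) k) :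
    ∃ φ' : L.BoundedFormula Empty (m + k), formulaCode φ' = renF (n, b, m) (formulaCode φ) ∧
      ∀ v : ℕ → ℝ, φ'.Realize default (fun i : Fin (m + k) => v i) ↔
        φ.Realize (fun i : Fin n => v (b + i)) fun j : Fin k => v (m + j) := by
  induction φ with
  | falsum => exact ⟨.falsum, by rw [formulaCode, formulaCode, renF_zero], fun v => Iff.rfl⟩
  | equal t u =>
    obtain ⟨t', h1, h2⟩ := exists_renT_term hbm t
    obtain ⟨u', h3, h4⟩ := exists_renT_term hbm u
    refine ⟨.equal t' u', by rw [formulaCode, formulaCode, renF_equal, h1, h3], fun v => ?_⟩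
    simp only [BoundedFormula.Realize, h2, h4]
  | rel R ts =>
    choose us h1 h2 using fun i => exists_renT_term hbm (ts i)
    refine ⟨.rel R us, ?_, fun v => ?_⟩
    · rw [formulaCode, formulaCode, renF_rel, renL_encode, List.map_ofFn]
      simp only [h1, Function.comp_def]
    · simp only [BoundedFormula.Realize, h2]
  | imp φ ψ ih1 ih2 =>
    obtain ⟨φ', h1, h2⟩ := ih1
    obtain ⟨ψ', h3, h4⟩ := ih2
    refine ⟨.imp φ' ψ', by rw [formulaCode, formulaCode, renF_imp, h1, h3], fun v => ?_⟩
    simp only [BoundedFormula.Realize, h2, h4]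
  | @all k φ ih =>
    obtain ⟨φ', h1, h2⟩ := ih
    refine ⟨.all (n := m + k) φ', by rw [formulaCode, formulaCode, renF_all, h1], fun v => ?_⟩
    simp only [BoundedFormula.Realize]
    refine forall_congr' fun a => ?_
    have e1 := snoc_eq_update (k := m + k) v a
    have e2 : (Fin.snoc (fun j : Fin k => v (m + j)) a : Fin (k + 1) → ℝ) =
        fun j : Fin (k + 1) => Function.update v (m + k) a (m + j) := by
      ext j
      refine Fin.lastCases ?_ (fun j => ?_) j
      · simp
      · have hj := j.2
        simp [hj.ne]
    have e3 : (fun i : Fin n => v (b + i)) =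
        fun i : Fin n => Function.update v (m + k) a (b + i) := by
      ext i
      have hi := i.2
      rw [Function.update_of_ne (by omega)]
    rw [e1, e2, e3]
    exact h2 _

end Codes

open Language

/-! ### Conditions expressed by coded formulas -/

section Expressible

variable {L : Language} [L.Structure ℝ]
  [∀ n, Encodable (L.Functions n)] [∀ n, Encodable (L.Relations n)]

/-- `c` is the Gödel number of a formula in the bound variables `0, …, k - 1` that expresses the
condition `P`. -/
def Codes (L : Language) [L.Structure ℝ] [∀ n, Encodable (L.Functions n)]
    [∀ n, Encodable (L.Relations n)] (k c : ℕ) (P : (ℕ → ℝ) → Prop) : Prop :=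
  ∃ φ : L.BoundedFormula Empty k, formulaCode φ = c ∧
    ∀ v : ℕ → ℝ, φ.Realize default (fun i : Fin k => v i) ↔ P v

variable {k c c' : ℕ} {P P' : (ℕ → ℝ) → Prop}

theorem Codes.congr (h : Codes L k c P) (hP : ∀ v, P v ↔ P' v) : Codes L k c P' := by
  obtain ⟨φ, h1, h2⟩ := h
  exact ⟨φ, h1, fun v => (h2 v).trans (hP v)⟩

theorem codes_falsum : Codes L k (Nat.pair 0 0) fun _ => False :=
  ⟨.falsum, by rw [formulaCode], fun _ => Iff.rfl⟩

theorem Codes.imp (h : Codes L k c P) (h' : Codes L k c' P') :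
    Codes L k (Nat.pair 3 (Nat.pair c c')) fun v => P v → P' v := by
  obtain ⟨φ, h1, h2⟩ := h
  obtain ⟨ψ, h3, h4⟩ := h'
  refine ⟨.imp φ ψ, by rw [formulaCode, h1, h3], fun v => ?_⟩
  simp only [BoundedFormula.Realize, h2, h4]

theorem Codes.all (h : Codes L (k + 1) c P) :
    Codes L k (Nat.pair 4 c) fun v => ∀ a, P (Function.update v k a) := by
  obtain ⟨φ, h1, h2⟩ := h
  refine ⟨.all φ, by rw [formulaCode, h1], fun v => ?_⟩
  simp only [BoundedFormula.Realize, snoc_eq_update, h2]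

/-- The code of the negation. -/
def notCode (c : ℕ) : ℕ := Nat.pair 3 (Nat.pair c (Nat.pair 0 0))

/-- The code of the conjunction. -/
def andCode (c c' : ℕ) : ℕ := notCode (Nat.pair 3 (Nat.pair c (notCode c')))

theorem Codes.not (h : Codes L k c P) : Codes L k (notCode c) fun v => ¬ P v :=
  h.imp codes_falsum

theorem Codes.and (h : Codes L k c P) (h' : Codes L k c' P') :
    Codes L k (andCode c c') fun v => P v ∧ P' v :=
  (h.imp h'.not).not.congr fun v => by tauto

/-- The code of the conjunction of `f 0, …, f (n - 1)`. -/
def conjCode (f : ℕ → ℕ) : ℕ → ℕ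
  | 0 => notCode (Nat.pair 0 0)
  | n + 1 => andCode (conjCode f n) (f n)

theorem codes_conj {f : ℕ → ℕ} {Q : ℕ → (ℕ → ℝ) → Prop} (n : ℕ)
    (h : ∀ t < n, Codes L k (f t) (Q t)) :
    Codes L k (conjCode f n) fun v => ∀ t : Fin n, Q t v := by
  induction n with
  | zero => exact codes_falsum.not.congr fun v => by simp
  | succ n ih =>
    refine ((ih fun t ht => h t (by omega)).and (h n (by omega))).congr fun v => ?_
    rw [Fin.forall_fin_succ']
    simp

/-- Overwrite the `n` values of `v` from index `k` on by `u`. -/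
def blockUpdate {n : ℕ} (v : ℕ → ℝ) (k : ℕ) (u : Fin n → ℝ) (i : ℕ) : ℝ :=
  if h : k ≤ i ∧ i < k + n then u ⟨i - k, by omega⟩ else v i

theorem Codes.iterate_all {n : ℕ} (h : Codes L (k + n) c P) :
    Codes L k ((Nat.pair 4)^[n] c) fun v => ∀ u : Fin n → ℝ, P (blockUpdate v k u) := by
  induction n generalizing c P with
  | zero =>
    refine Codes.congr (P := P) h fun v => ?_
    have : ∀ u : Fin 0 → ℝ, blockUpdate v k u = v := by
      intro u; ext i
      rw [blockUpdate, dif_neg (by omega)]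
    simp [this]
  | succ n ih =>
    rw [Function.iterate_succ_apply]
    refine (ih (Codes.all (k := k + n) h)).congr fun v => ?_
    -- The innermost quantifier binds the last coordinate of the block.
    have key : ∀ (u : Fin n → ℝ) (a : ℝ), Function.update (blockUpdate v k u) (k + n) a =
        blockUpdate v k (Fin.snoc u a : Fin (n + 1) → ℝ) := by
      intro u a
      ext i
      rw [Function.update_apply, blockUpdate, blockUpdate]
      split_ifs with h1 h2 h3 h4
      · subst h1
        have : (⟨k + n - k, by omega⟩ : Fin (n + 1)) = Fin.last n := by ext; simp
        rw [this, Fin.snoc_last]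
      · omega
      · have : (⟨i - k, by omega⟩ : Fin (n + 1)) = Fin.castSucc ⟨i - k, by omega⟩ := by ext; simp
        rw [this, Fin.snoc_castSucc]
      · omega
      · omega
      · rfl
    constructor
    · intro H u
      rw [← Fin.snoc_init_self u, ← key]
      exact H _ _
    · intro H u a
      rw [key]
      exact H _

end Expressible

/-! ### Codes of the atomic conditions -/

section Atoms

variable {L : Language} (ι : lang →ᴸ L)

theorem realize_sum [L.Structure ℝ] [ι.IsExpansionOn ℝ] {k : ℕ} (i j : Fin k) (v : ℕ → ℝ) :
    ((ι.onFunction addFunc).apply₂ (.var (Sum.inr i)) (.var (Sum.inr j)) :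
      L.Term (Empty ⊕ Fin k)).realize (Sum.elim default fun i : Fin k => v i) = v i + v j := by
  rw [Term.realize_functions_apply₂, LHom.map_onFunction]
  rfl

variable [∀ n, Encodable (L.Functions n)]

/-- The code of the bound variable `i`. -/
def varCode (i : ℕ) : ℕ := Nat.pair 0 (2 * i + 1)

/-- The code of a list of two terms with given codes. -/
def pairCode (s t : ℕ) : ℕ := Nat.pair s (Nat.pair t 0 + 1) + 1

/-- The code of the term `xᵢ + xⱼ`. -/
def sumCode (i j : ℕ) : ℕ :=
  Nat.pair 1 (Nat.pair (Encodable.encode (ι.onFunction addFunc))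
    (pairCode (varCode i) (varCode j)))

/-- The code of the formula `xᵢ + xⱼ = xₗ`. -/
def addCode (i j l : ℕ) : ℕ := Nat.pair 1 (Nat.pair (sumCode ι i j) (varCode l))

/-- The code of the formula `xᵢ = 0 ∨ xⱼ = 0`. -/
def disjCode (i j : ℕ) : ℕ :=
  Nat.pair 3 (Nat.pair (notCode (addCode ι i i i)) (addCode ι j j j))

theorem termCode_var {k : ℕ} (i : Fin k) :
    termCode (.var (Sum.inr i) : L.Term (Empty ⊕ Fin k)) = varCode i := by
  rw [termCode, Encodable.encode_inr]; rfl

theorem encode_ofFn_two (f : Fin 2 → ℕ) :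
    Encodable.encode (List.ofFn f) = pairCode (f 0) (f 1) := by
  simp [List.ofFn_succ, pairCode]

theorem termCode_sum {k : ℕ} (i j : Fin k) :
    termCode ((ι.onFunction addFunc).apply₂ (.var (Sum.inr i)) (.var (Sum.inr j)) :
      L.Term (Empty ⊕ Fin k)) = sumCode ι i j := by
  rw [Functions.apply₂, termCode, encode_ofFn_two, sumCode]
  simp only [Matrix.cons_val_zero, Matrix.cons_val_one, termCode_var]

variable [∀ n, Encodable (L.Relations n)]

/-- The code of the formula `xᵢ < xⱼ + xₗ`. -/
def ltCode (i j l : ℕ) : ℕ :=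
  Nat.pair 2 (Nat.pair (Encodable.encode (ι.onRelation ltRel))
    (pairCode (varCode i) (sumCode ι j l)))

variable [L.Structure ℝ] [ι.IsExpansionOn ℝ]

theorem codes_add {k i j l : ℕ} (hi : i < k) (hj : j < k) (hl : l < k) :
    Codes L k (addCode ι i j l) fun v => v i + v j = v l := by
  refine ⟨.equal ((ι.onFunction addFunc).apply₂ (.var (Sum.inr ⟨i, hi⟩)) (.var (Sum.inr ⟨j, hj⟩)))
    (.var (Sum.inr ⟨l, hl⟩)), ?_, fun v => ?_⟩
  · rw [formulaCode, termCode_sum, termCode_var]; rfl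
  · rw [BoundedFormula.Realize, realize_sum]; rfl

theorem codes_lt {k i j l : ℕ} (hi : i < k) (hj : j < k) (hl : l < k) :
    Codes L k (ltCode ι i j l) fun v => v i < v j + v l := by
  refine ⟨.rel (ι.onRelation ltRel) ![.var (Sum.inr ⟨i, hi⟩),
    (ι.onFunction addFunc).apply₂ (.var (Sum.inr ⟨j, hj⟩)) (.var (Sum.inr ⟨l, hl⟩))],
    ?_, fun v => ?_⟩
  · rw [formulaCode, encode_ofFn_two, ltCode]
    simp only [Matrix.cons_val_zero, Matrix.cons_val_one, termCode_sum, termCode_var]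
  · rw [BoundedFormula.Realize, LHom.map_onRelation]
    exact iff_of_eq (congrArg (fun z => v i < z) (realize_sum ι ⟨j, hj⟩ ⟨l, hl⟩ v))

/-- A real is zero exactly if it equals its double, so addition alone expresses the vanishing of a
coordinate. -/
theorem codes_disj {k i j : ℕ} (hi : i < k) (hj : j < k) :
    Codes L k (disjCode ι i j) fun v => v i = 0 ∨ v j = 0 := by
  refine ((codes_add ι hi hi hi).not.imp (codes_add ι hj hj hj)).congr fun v => ?_
  simp only [add_eq_left]
  tauto

end Atoms

theorem primrec_notCode : Primrec notCode :=
  Primrec₂.natPair.comp (Primrec.const 3) (Primrec₂.natPair.comp Primrec.id (Primrec.const _))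

theorem primrec_andCode : Primrec₂ andCode :=
  primrec_notCode.comp (Primrec₂.natPair.comp (Primrec.const 3)
    (Primrec₂.natPair.comp Primrec.fst (primrec_notCode.comp Primrec.snd)))

theorem primrec_conjCode {f : ℕ → ℕ → ℕ} (hf : Primrec₂ f) :
    Primrec fun n => conjCode (f n) n := by
  have h : Primrec₂ fun n m => conjCode (f n) m := by
    refine (Primrec.nat_rec (f := fun _ => notCode (Nat.pair 0 0))
      (g := fun (n : ℕ) (p : ℕ × ℕ) => andCode p.2 (f n p.1)) (Primrec.const _) ?_).of_eq ?_
    · exact primrec_andCode.comp (Primrec.snd.comp Primrec.snd)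
        (hf.comp Primrec.fst (Primrec.fst.comp Primrec.snd))
    · intro n m
      induction m with
      | zero => rfl
      | succ m ih => simp only [conjCode, ← ih]
  exact h.comp Primrec.id Primrec.id

/-! ### Primitive recursiveness of the codes -/

section Primrec

variable {L : Language} [∀ n, Encodable (L.Functions n)] (ι : lang →ᴸ L)
variable {γ : Type} [Primcodable γ] {f g h : γ → ℕ}

theorem primrec_varCode (hf : Primrec f) : Primrec fun x => varCode (f x) :=
  Primrec₂.natPair.comp (Primrec.const 0)
    (Primrec.succ.comp (Primrec.nat_mul.comp (Primrec.const 2) hf))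

theorem primrec_pairCode (hf : Primrec f) (hg : Primrec g) :
    Primrec fun x => pairCode (f x) (g x) :=
  Primrec.succ.comp (Primrec₂.natPair.comp hf
    (Primrec.succ.comp (Primrec₂.natPair.comp hg (Primrec.const 0))))

theorem primrec_sumCode (hf : Primrec f) (hg : Primrec g) :
    Primrec fun x => sumCode ι (f x) (g x) :=
  Primrec₂.natPair.comp (Primrec.const 1) (Primrec₂.natPair.comp (Primrec.const _)
    (primrec_pairCode (primrec_varCode hf) (primrec_varCode hg)))

theorem primrec_addCode (hf : Primrec f) (hg : Primrec g) (hh : Primrec h) :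
    Primrec fun x => addCode ι (f x) (g x) (h x) :=
  Primrec₂.natPair.comp (Primrec.const 1)
    (Primrec₂.natPair.comp (primrec_sumCode ι hf hg) (primrec_varCode hh))

theorem primrec_disjCode (hf : Primrec f) (hg : Primrec g) :
    Primrec fun x => disjCode ι (f x) (g x) :=
  Primrec₂.natPair.comp (Primrec.const 3) (Primrec₂.natPair.comp
    (primrec_notCode.comp (primrec_addCode ι hf hf hf)) (primrec_addCode ι hg hg hg))

theorem primrec_ltCode [∀ n, Encodable (L.Relations n)] (hf : Primrec f) (hg : Primrec g) (hh : Primrec h) :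
    Primrec fun x => ltCode ι (f x) (g x) (h x) :=
  Primrec₂.natPair.comp (Primrec.const 2) (Primrec₂.natPair.comp (Primrec.const _)
    (primrec_pairCode (primrec_varCode hf) (primrec_sumCode ι hg hh)))

theorem primrec_iterate_all (hf : Primrec f) (hg : Primrec g) :
    Primrec fun x => (Nat.pair 4)^[f x] (g x) :=
  Primrec.nat_iterate hf hg (Primrec₂.natPair.comp (Primrec.const 4) Primrec.snd)

end Primrec

/-! ### The criterion as a formula over vectors, uniform in the dimension -/

/-- Formulas about a subset of `ℝⁿ`, with variables for vectors that are numbered from the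
outermost quantifier on. -/
inductive VecFormula
  | falsum : VecFormula
  | mem (i : ℕ) : VecFormula
  | add (i j l : ℕ) : VecFormula
  | lt (i j l : ℕ) : VecFormula
  | disj (i j : ℕ) : VecFormula
  | imp (φ ψ : VecFormula) : VecFormula
  | all (φ : VecFormula) : VecFormula

namespace VecFormula

/-- Satisfaction, at quantifier depth `d`. -/
def Sat {n : ℕ} (X : Set (Fin n → ℝ)) : VecFormula → ℕ → (ℕ → Fin n → ℝ) → Prop
  | falsum, _, _ => False
  | mem i, _, u => u i ∈ X
  | add i j l, _, u => u i + u j = u l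
  | lt i j l, _, u => ∀ t, u i t < u j t + u l t
  | disj i j, _, u => Disj (u i) (u j)
  | imp φ ψ, d, u => φ.Sat X d u → ψ.Sat X d u
  | all φ, d, u => ∀ x, φ.Sat X (d + 1) (Function.update u d x)

/-- All variables are less than the quantifier depth. -/
def Closed : VecFormula → ℕ → Prop
  | falsum, _ => True
  | mem i, d => i < d
  | add i j l, d => i < d ∧ j < d ∧ l < d
  | lt i j l, d => i < d ∧ j < d ∧ l < d
  | disj i j, d => i < d ∧ j < d
  | imp φ ψ, d => φ.Closed d ∧ ψ.Closed d
  | all φ, d => φ.Closed (d + 1)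

section Code

variable {L : Language} [∀ n, Encodable (L.Functions n)] [∀ n, Encodable (L.Relations n)]
  (ι : lang →ᴸ L)

/-- The code of the first-order formula for a subset of `ℝⁿ` that is defined by the formula with
code `c`. -/
def code (n c : ℕ) : VecFormula → ℕ → ℕ
  | falsum, _ => Nat.pair 0 0
  | mem i, d => renF (n, i * n, d * n) c
  | add i j l, _ => conjCode (fun t => addCode ι (i * n + t) (j * n + t) (l * n + t)) n
  | lt i j l, _ => conjCode (fun t => ltCode ι (i * n + t) (j * n + t) (l * n + t)) n
  | disj i j, _ => conjCode (fun t => disjCode ι (i * n + t) (j * n + t)) n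
  | imp φ ψ, d => Nat.pair 3 (Nat.pair (code n c φ d) (code n c ψ d))
  | all φ, d => (Nat.pair 4)^[n] (code n c φ (d + 1))

/-- The vector variable `i` occupies the block of real variables from `i * n` to `i * n + n - 1`; a
vector quantifier becomes `n` real ones, and a coordinatewise condition an `n`-fold conjunction. -/
theorem codes_code [L.Structure ℝ] [ι.IsExpansionOn ℝ] {n : ℕ} (ψ : L.Formula (Fin n))
    (φ : VecFormula) (d : ℕ) (hφ : φ.Closed d) :
    Codes L (d * n) (code ι n (formulaCode ψ) φ d) fun v =>
      φ.Sat {x | ψ.Realize x} d fun i (t : Fin n) => v (i * n + t) := by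
  have hlt : ∀ {d i t : ℕ}, i < d → t < n → i * n + t < d * n := by
    intro d i t hi ht
    nlinarith
  induction φ generalizing d with
  | falsum => exact codes_falsum
  | mem i =>
    obtain ⟨φ', h1, h2⟩ := exists_renF_formula (b := i * n) (m := d * n) (k := 0)
      (by have : i + 1 ≤ d := hφ
          nlinarith) ψ
    refine ⟨φ', h1, fun v => (h2 v).trans ?_⟩
    change _ ↔ BoundedFormula.Realize ψ _ _
    congr! 1
  | add i j l =>
    refine (codes_conj n fun t ht => codes_add ι (hlt hφ.1 ht) (hlt hφ.2.1 ht)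
      (hlt hφ.2.2 ht)).congr fun v => ?_
    exact funext_iff.symm
  | lt i j l =>
    exact codes_conj n fun t ht => codes_lt ι (hlt hφ.1 ht) (hlt hφ.2.1 ht) (hlt hφ.2.2 ht)
  | disj i j =>
    exact codes_conj n fun t ht => codes_disj ι (hlt hφ.1 ht) (hlt hφ.2 ht)
  | imp φ χ h1 h2 => exact (h1 d hφ.1).imp (h2 d hφ.2)
  | all φ ih =>
    have h := ih (d + 1) hφ
    rw [add_mul, one_mul] at h
    refine h.iterate_all.congr fun v => forall_congr' fun x => ?_
    congr! 1
    ext i t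
    have ht := t.2
    rw [Function.update_apply, blockUpdate]
    split_ifs with h1 h2 h3
    · subst h2
      congr 1
      ext
      simp
    · exfalso
      rcases Nat.lt_or_gt_of_ne h2 with h4 | h4
      · have := hlt (d := d) h4 ht
        omega
      · have : d + 1 ≤ i := h4
        nlinarith
    · exfalso
      subst h3
      omega
    · rfl

/-- The induction over the fixed formula `φ` takes place outside the computation; only `n` and `c`
are inputs. -/
theorem primrec_code (φ : VecFormula) (d : ℕ) : Primrec₂ fun n c => code ι n c φ d := by
  have hidx : ∀ i : ℕ, Primrec fun p : ℕ × ℕ => i * p.1 + p.2 := fun i =>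
    Primrec.nat_add.comp (Primrec.nat_mul.comp (Primrec.const i) Primrec.fst) Primrec.snd
  induction φ generalizing d with
  | falsum => exact Primrec.const _
  | mem i =>
    have h : ∀ i : ℕ, Primrec fun p : ℕ × ℕ => i * p.1 := fun i =>
      Primrec.nat_mul.comp (Primrec.const i) Primrec.fst
    exact primrec_renF.comp (Primrec.pair Primrec.fst (Primrec.pair (h i) (h d))) Primrec.snd
  | add i j l =>
    exact (primrec_conjCode (f := fun n t => addCode ι (i * n + t) (j * n + t) (l * n + t))
      (primrec_addCode ι (hidx i) (hidx j) (hidx l))).comp Primrec.fst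
  | lt i j l =>
    exact (primrec_conjCode (f := fun n t => ltCode ι (i * n + t) (j * n + t) (l * n + t))
      (primrec_ltCode ι (hidx i) (hidx j) (hidx l))).comp Primrec.fst
  | disj i j =>
    exact (primrec_conjCode (f := fun n t => disjCode ι (i * n + t) (j * n + t))
      (primrec_disjCode ι (hidx i) (hidx j))).comp Primrec.fst
  | imp φ ψ h1 h2 =>
    exact Primrec₂.natPair.comp (Primrec.const 3) (Primrec₂.natPair.comp (h1 d) (h2 d))
  | all φ ih => exact primrec_iterate_all Primrec.fst (ih (d + 1))

end Code

/-- Negation. -/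
def not (φ : VecFormula) : VecFormula := φ.imp falsum

/-- Conjunction. -/
def and (φ ψ : VecFormula) : VecFormula := (φ.imp ψ.not).not

/-- Disjunction. -/
def or (φ ψ : VecFormula) : VecFormula := φ.not.imp ψ

/-- Equivalence. -/
def iff (φ ψ : VecFormula) : VecFormula := (φ.imp ψ).and (ψ.imp φ)

/-- Existential quantification. -/
def ex (φ : VecFormula) : VecFormula := φ.not.all.not

/-- The formula for `Near xᵢ xⱼ xₗ`. -/
def near (i j l : ℕ) : VecFormula := (lt i j l).and (lt j i l)

/-- The formula for `xᵢ = 0`. -/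
def isZero (i : ℕ) : VecFormula := add i i i

section Sat

variable {n : ℕ} (X : Set (Fin n → ℝ)) (d : ℕ) (u : ℕ → Fin n → ℝ) (φ ψ : VecFormula)

@[simp] theorem sat_mem (i : ℕ) : (mem i).Sat X d u ↔ u i ∈ X := Iff.rfl

@[simp] theorem sat_add (i j l : ℕ) : (add i j l).Sat X d u ↔ u i + u j = u l := Iff.rfl

@[simp] theorem sat_lt (i j l : ℕ) : (lt i j l).Sat X d u ↔ ∀ t, u i t < u j t + u l t := Iff.rfl

@[simp] theorem sat_disj (i j : ℕ) : (disj i j).Sat X d u ↔ Disj (u i) (u j) := Iff.rfl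

@[simp] theorem sat_imp : (imp φ ψ).Sat X d u ↔ (φ.Sat X d u → ψ.Sat X d u) := Iff.rfl

@[simp] theorem sat_all : φ.all.Sat X d u ↔ ∀ x, φ.Sat X (d + 1) (Function.update u d x) := Iff.rfl

@[simp] theorem sat_not : φ.not.Sat X d u ↔ ¬ φ.Sat X d u := Iff.rfl

@[simp] theorem sat_and : (φ.and ψ).Sat X d u ↔ φ.Sat X d u ∧ ψ.Sat X d u := by
  simp only [VecFormula.and, sat_not, sat_imp]; tauto

@[simp] theorem sat_or : (φ.or ψ).Sat X d u ↔ φ.Sat X d u ∨ ψ.Sat X d u := by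
  simp only [VecFormula.or, sat_not, sat_imp]; tauto

@[simp] theorem sat_iff : (φ.iff ψ).Sat X d u ↔ (φ.Sat X d u ↔ ψ.Sat X d u) := by
  simp only [VecFormula.iff, sat_and, sat_imp]; tauto

@[simp] theorem sat_ex : φ.ex.Sat X d u ↔ ∃ x, φ.Sat X (d + 1) (Function.update u d x) := by
  simp only [ex, sat_not, sat_all, not_forall, not_not]

@[simp] theorem sat_near (i j l : ℕ) : (near i j l).Sat X d u ↔ Near (u i) (u j) (u l) := by
  simp only [near, sat_and, sat_lt, Near, forall_and]

@[simp] theorem sat_isZero (i : ℕ) : (isZero i).Sat X d u ↔ u i = 0 := by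
  simp only [isZero, sat_add, add_eq_left]

end Sat

/-- The scaling criterion, in the presence of the zero vector as variable `0`. -/
def scaling : VecFormula :=
  -- The variables 1, 2, 3, 4 are `x`, `r`, `y`, `z`. The further ones name intermediate sums: first
  -- 5 is `x + y`; then 5, 6, 7 are `x + x`, `x + x + y`, `z + z`.
  all <| ex <| (lt 0 0 2).and <| all <| (near 1 3 2).imp <| all <|
    (all <| (add 1 3 5).imp <| (add 4 4 5).imp <| (mem 3).iff (mem 4)).and
    (all <| all <| all <| (add 1 1 5).imp <| (add 5 3 6).imp <| (add 4 4 7).imp <|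
      (add 7 4 6).imp <| (mem 3).iff (mem 4))

/-- The section criterion, in the presence of the zero vector as variable `0`. -/
def sections : VecFormula :=
  -- The variables 1 to 8 are `e`, `R`, `x`, `s`, `r`, `v`, `y`, `y + v`.
  all <| ex <| all <| (disj 1 3).imp <| (near 0 3 2).or <| ex <| (lt 0 0 4).and <| all <|
    (lt 0 0 5).imp <| (lt 5 4 0).imp <| ex <| (isZero 6).not.and <| (disj 1 6).and <|
      (near 0 6 5).and <| all <| (disj 1 7).imp <| (near 3 7 5).imp <| all <| (add 7 6 8).imp <|
        (mem 7).iff (mem 8)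

/-- The conjunction of the scaling criterion and the section criterion. -/
def criterion : VecFormula := ex <| (isZero 0).and <| scaling.and sections

theorem closed_criterion : criterion.Closed 0 := by
  simp [criterion, scaling, sections, ex, VecFormula.and, VecFormula.or, VecFormula.not,
    VecFormula.iff, near, isZero, Closed]

theorem sat_criterion {n : ℕ} (X : Set (Fin n → ℝ)) (u : ℕ → Fin n → ℝ) :
    criterion.Sat X 0 u ↔ ScalingCriterion X ∧ SectionCriterion X := by
  have h1 : ∀ u : ℕ → Fin n → ℝ, u 0 = 0 → (scaling.Sat X 1 u ↔ ScalingCriterion X) := by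
    intro u hu
    simp [scaling, ScalingCriterion, hu]
  have h2 : ∀ u : ℕ → Fin n → ℝ, u 0 = 0 → (sections.Sat X 1 u ↔ SectionCriterion X) := by
    intro u hu
    simp [sections, SectionCriterion, hu]
  simp only [criterion, sat_ex, sat_and, sat_isZero, Function.update_self]
  constructor
  · rintro ⟨x, hx, h3, h4⟩
    exact ⟨(h1 _ (by simpa using hx)).1 h3, (h2 _ (by simpa using hx)).1 h4⟩
  · rintro ⟨h3, h4⟩
    exact ⟨0, rfl, (h1 _ (by simp)).2 h3, (h2 _ (by simp)).2 h4⟩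

end VecFormula

open Language

/-! ### The many-one reduction -/

section Decision

variable {L : Language}
  [∀ n, Encodable (L.Functions n)] [∀ n, Encodable (L.Relations n)]
  (ι : lang →ᴸ L)

theorem exists_of_formulaCode_eq_iterate_all {α : Type} [Encodable α] {k n c : ℕ}
    (φ : L.BoundedFormula α k) (h : formulaCode φ = (Nat.pair 4)^[n] c) :
    ∃ ψ : L.BoundedFormula α (k + n), formulaCode ψ = c := by
  induction n generalizing c with
  | zero => exact ⟨φ, h⟩
  | succ n ih =>
    obtain ⟨ψ, hψ⟩ := ih h
    exact exists_of_formulaCode_eq_all hψ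

/-- The code of the universal closure of the formula with code `c` in `n` free variables. -/
def closureCode (n c : ℕ) : ℕ := (Nat.pair 4)^[n] (renF (n, 0, n) c)

/-- The code of a sentence that says that a formula with code `c` in `n` free variables defines a
set that satisfies the criterion. If `c` is not the code of such a formula, then this is not the
code of a sentence. -/
def criterionCode (p : ℕ × ℕ) : ℕ :=
  Nat.pair 3 (Nat.pair (Nat.pair 3 (Nat.pair (closureCode p.1 p.2) (closureCode p.1 p.2)))
    (VecFormula.criterion.code ι p.1 p.2 0))

theorem primrec_criterionCode : Primrec (criterionCode ι) := by
  have h : Primrec fun p : ℕ × ℕ => closureCode p.1 p.2 :=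
    primrec_iterate_all Primrec.fst (primrec_renF.comp
      (Primrec.pair Primrec.fst (Primrec.pair (Primrec.const 0) Primrec.fst)) Primrec.snd)
  exact Primrec₂.natPair.comp (Primrec.const 3) (Primrec₂.natPair.comp
    (Primrec₂.natPair.comp (Primrec.const 3) (Primrec₂.natPair.comp h h))
    ((VecFormula.primrec_code ι _ 0).comp Primrec.fst Primrec.snd))

/-- The universal closure sits at a known place in the code, so stripping two implications and `n`
quantifiers exposes the renamed `c`. -/
theorem exists_formula_of_criterionCode {n c : ℕ} {σ : L.Sentence}
    (h : formulaCode σ = criterionCode ι (n, c)) : ∃ ψ : L.Formula (Fin n), formulaCode ψ = c := by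
  obtain ⟨τ, hτ⟩ := (exists_of_formulaCode_eq_imp h).1
  obtain ⟨χ, hχ⟩ := (exists_of_formulaCode_eq_imp hτ).1
  obtain ⟨φ, hφ⟩ := exists_of_formulaCode_eq_iterate_all χ hχ
  exact exists_formula_of_renF_eq (m := n) (k := 0) φ (by omega) hφ.symm

/-- The antecedent is an implication from the closure to itself, hence true, so the sentence has the
truth value of the criterion. -/
theorem exists_sentence_criterionCode [L.Structure ℝ] [ι.IsExpansionOn ℝ] {n : ℕ} (ψ : L.Formula (Fin n)) :
    ∃ σ : L.Sentence, formulaCode σ = criterionCode ι (n, formulaCode ψ) ∧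
      (σ.Realize ℝ ↔ ScalingCriterion {x | ψ.Realize x} ∧ SectionCriterion {x | ψ.Realize x}) := by
  obtain ⟨φ, h1, -⟩ := exists_renF_formula (b := 0) (m := n) (k := 0) (by omega) ψ
  have hcl : Codes L (0 + n) (renF (n, 0, n) (formulaCode ψ))
      fun v => φ.Realize default fun i : Fin n => v i := by
    rw [zero_add]
    exact ⟨φ, h1, fun v => Iff.rfl⟩
  have hcrit := VecFormula.codes_code ι ψ _ 0 VecFormula.closed_criterion
  rw [zero_mul] at hcrit
  obtain ⟨σ, h2, h3⟩ := (hcl.iterate_all.imp hcl.iterate_all).imp hcrit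
  refine ⟨σ, h2, ?_⟩
  have h4 := h3 fun _ => 0
  beta_reduce at h4
  rw [VecFormula.sat_criterion] at h4
  have h5 : Sentence.Realize ℝ σ ↔
      BoundedFormula.Realize σ default fun i : Fin 0 => (fun _ : ℕ => (0 : ℝ)) i := by
    rw [Sentence.Realize, Formula.Realize]
    congr! 1
  rw [h5, h4]
  tauto

end Decision

end RealAdd

/-- Let `L` be a signature with numbered symbols that contains `{+, <, 1}` (through `ι`), and let
`ℝ` carry an `L`-structure that expands `⟨ℝ, +, <, 1⟩`, is decidable, and in which every nonempty
definable relation has a rational point. Then the set of pairs `(n, c)` such that `c` is the Gödel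
number of an `L`-formula in the free variables `x₀, …, xₙ₋₁` which defines a
`⟨ℝ, +, <, 1⟩`-definable subset of `ℝⁿ` is recursive. -/
theorem theorem6p1 (L : FirstOrder.Language) [L.Structure ℝ]
    [∀ n, Encodable (L.Functions n)] [∀ n, Encodable (L.Relations n)]
    (ι : RealAdd.lang →ᴸ L) [ι.IsExpansionOn ℝ]
    (hdec : RealAdd.IsDecidable L)
    (hrat : ∀ (n : ℕ) (X : Set (Fin n → ℝ)), RealAdd.IsDefinable L X → X.Nonempty →
      ∃ q : Fin n → ℚ, (fun i => (q i : ℝ)) ∈ X) :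
    ComputablePred fun p : ℕ × ℕ => ∃ ψ : L.Formula (Fin p.1),
      RealAdd.formulaCode ψ = p.2 ∧
        RealAdd.IsDefinable RealAdd.lang {x : Fin p.1 → ℝ | ψ.Realize x} := by
  refine ComputablePred.computable_of_manyOneReducible
    ⟨RealAdd.criterionCode ι, (RealAdd.primrec_criterionCode ι).to_comp, ?_⟩ hdec
  rintro ⟨n, c⟩
  change (∃ ψ : L.Formula (Fin n), RealAdd.formulaCode ψ = c ∧
      RealAdd.IsDefinable RealAdd.lang {x : Fin n → ℝ | ψ.Realize x}) ↔
    ∃ σ : L.Sentence, RealAdd.formulaCode σ = RealAdd.criterionCode ι (n, c) ∧ σ.Realize ℝ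
  constructor
  · rintro ⟨ψ, rfl, hψ⟩
    obtain ⟨σ, h1, h2⟩ := RealAdd.exists_sentence_criterionCode ι ψ
    exact ⟨σ, h1, h2.2 ⟨hψ.signDetermined.scalingCriterion, hψ.signDetermined.sectionCriterion⟩⟩
  · rintro ⟨σ, h1, h2⟩
    obtain ⟨ψ, rfl⟩ := RealAdd.exists_formula_of_criterionCode ι h1
    obtain ⟨σ', h3, h4⟩ := RealAdd.exists_sentence_criterionCode ι ψ
    -- Injectivity of the coding identifies the given true sentence with the one built from `ψ`, so
    -- the criterion holds for `ψ`.
    obtain rfl : σ = σ' := RealAdd.formulaCode_injective (h1.trans h3.symm)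
    obtain ⟨h5, h6⟩ := h4.1 h2
    exact ⟨ψ, rfl, RealAdd.isDefinable_of_criterion ι hrat (Set.empty_definable_iff.2 ⟨ψ, rfl⟩) h5 h6⟩
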